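/- Let $\Lambda$ be an artin algebra, i.e. an algebra over a commutative artinian ring $k$ that is finitely generated as a $k$-module. Let $\operatorname{mod}\Lambda$ be the category of finitely generated right $\Lambda$-modules and $D^b(\operatorname{mod}\Lambda)$ its bounded derived category. For a triangulated category $\mathcal T$, let $\operatorname{tri.dim}\mathcal T$ be the least $d\ge 0$ such that $\mathcal T=\langle M\rangle_{d+1}$ for some object $M$ (and $\infty$ if there is none), where $\langle M\rangle_1$ consists of the direct summands of finite direct sums of shifts of $M$, and $\langle M\rangle_{j+1}$ consists of the direct summands of the objects $X$ that lie in a distinguished triangle $X_1\to X\to X_2\to X_1[1]$ with $X_1\in\langle M\rangle_1$, $X_2\in\langle M\rangle_{j}$. Call $\operatorname{tri.dim}D^b(\operatorname{mod}\Lambda)$ the derived dimension of $\Lambda$. For an integer $n\ge 0$, $\Lambda$ is an $n$-Igusa–Todorov algebra if there is $V\in\operatorname{mod}\Lambda$ such that for every $M\in\operatorname{mod}\Lambda$ there is an exact sequence $0\to V_1\to V_0\to\Omega^n(M)\to 0$ with $V_0,V_1\in\operatorname{add}V$; here $\Omega^0(M)=M$, $\Omega^{n+1}(M)$ is the kernel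 of a projective cover of $\Omega^n(M)$, and $\operatorname{add}V$ consists of the direct summands of finite direct sums of copies of $V$. (1) If $\Lambda$ is an $n$-Igusa–Todorov algebra with $n\ge 1$, then $\operatorname{tri.dim}D^b(\operatorname{mod}\Lambda)\le n+2$; if $\Lambda$ is a $0$-Igusa–Todorov algebra, then $\operatorname{tri.dim}D^b(\operatorname{mod}\Lambda)\le 3$. (That is, the bound is $2+\max\{1,n\}$ for every $n\ge 0$.) (2) In particular, $\operatorname{tri.dim}D^b(\operatorname{mod}\Lambda)\le 3$ for every $1$-Igusa–Todorov algebra $\Lambda$. (3) If $p\ge 0$, $\operatorname{rad}^{2p+1}\Lambda=0$ and $\Lambda/\operatorname{rad}^p\Lambda$ is representation-finite (there are only finitely many isomorphism classes of indecomposable finitely generated right modules over it), then $\Lambda$ is a $1$-Igusa–Todorov algebra, and hence $\operatorname{tri.dim}D^b(\operatorname{mod}\Lambda)\le 3$. -/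

import Mathlib

open CategoryTheory CategoryTheory.Limits

universe u v w

/-- `Λ` is an artin algebra: it is an algebra, finitely generated as a module, over a commutative
artinian ring `k`.  (The image of `k` in `Λ` may replace `k`, so taking `k` in the universe
of `Λ` is no restriction.) -/
class IsArtinAlgebra (Λ : Type u) [Ring Λ] : Prop where
  exists_base : ∃ (k : Type u) (_ : CommRing k) (_ : IsArtinianRing k) (_ : Algebra k Λ),
    Module.Finite k Λ

instance IsArtinAlgebra.isNoetherianRing_mulOpposite (Λ : Type u) [Ring Λ] [IsArtinAlgebra Λ] :
    IsNoetherianRing Λᵐᵒᵖ := by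
  obtain ⟨k, _, _, _, _⟩ := IsArtinAlgebra.exists_base (Λ := Λ)
  have : Module.Finite k Λᵐᵒᵖ := Module.Finite.equiv (MulOpposite.opLinearEquiv k)
  exact isNoetherian_of_tower k (isNoetherian_of_isNoetherianRing_of_finite k Λᵐᵒᵖ)

instance IsArtinAlgebra.quotient (Λ : Type u) [Ring Λ] [IsArtinAlgebra Λ] (I : Ideal Λ)
    [I.IsTwoSided] : IsArtinAlgebra (Λ ⧸ I) := by
  obtain ⟨k, _, _, _, _⟩ := IsArtinAlgebra.exists_base (Λ := Λ)
  exact ⟨k, inferInstance, inferInstance, inferInstance,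
    Module.Finite.of_surjective (Ideal.Quotient.mkₐ k I).toLinearMap
      (Ideal.Quotient.mkₐ_surjective k I)⟩

/-- `mod Λ`, the category of finitely generated right `Λ`-modules. -/
abbrev RightMod (Λ : Type u) [Ring Λ] : Type (u + 1) := FGModuleCat.{u} Λᵐᵒᵖ

section AbelianCategory

variable {C : Type u} [Category.{v} C] [Abelian C]

attribute [local instance] Abelian.hasFiniteBiproducts

/-- `X ∈ add V`: `X` is a direct summand of a finite direct sum of copies of `V`. -/
def MemAdd (V X : C) : Prop :=
  ∃ m : ℕ, Nonempty (Retract X (⨁ fun _ : Fin m => V))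

/-- `f : P ⟶ X` is a projective cover: `P` is projective and `f` is an essential epimorphism. -/
structure IsProjectiveCover {P X : C} (f : P ⟶ X) : Prop where
  projective : Projective P
  epi : Epi f
  essential : ∀ {Y : C} (g : Y ⟶ P), Epi (g ≫ f) → Epi g

/-- `IsSyzygy n X Y`: `Y` is (isomorphic to) the `n`-th syzygy `Ωⁿ(X)`, where `Ω⁰(X) = X` and
`Ωⁿ⁺¹(X)` is the kernel of a projective cover of `Ωⁿ(X)`. -/
def IsSyzygy : ℕ → C → C → Prop
  | 0, X, Y => Nonempty (Y ≅ X)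
  | n + 1, X, Y => ∃ (Z P : C) (f : P ⟶ Z),
      IsSyzygy n X Z ∧ IsProjectiveCover f ∧ Nonempty (Y ≅ kernel f)

/-- There is an exact sequence `0 ⟶ V₁ ⟶ V₀ ⟶ Y ⟶ 0` with `V₀, V₁ ∈ add V`. -/
def HasTwoTermAddResolution (V Y : C) : Prop :=
  ∃ (V₁ V₀ : C) (i : V₁ ⟶ V₀) (q : V₀ ⟶ Y) (h : i ≫ q = 0),
    (ShortComplex.mk i q h).ShortExact ∧ MemAdd V V₁ ∧ MemAdd V V₀

end AbelianCategory

/-- The artin algebra `Λ` is `n`-Igusa-Todorov: for some `V` in `mod Λ`, the `n`-th syzygy of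
every `M` in `mod Λ` admits an exact sequence `0 ⟶ V₁ ⟶ V₀ ⟶ Ωⁿ(M) ⟶ 0` with
`V₀, V₁ ∈ add V`. -/
def IsIgusaTodorov (n : ℕ) (Λ : Type u) [Ring Λ] [IsArtinAlgebra Λ] : Prop :=
  ∃ V : RightMod Λ, ∀ M : RightMod Λ, ∃ Y : RightMod Λ,
    IsSyzygy n M Y ∧ HasTwoTermAddResolution V Y

/-- `Λ` is representation-finite: up to isomorphism there are only finitely many indecomposable
finitely generated right `Λ`-modules. -/
def IsRepresentationFinite (Λ : Type u) [Ring Λ] [IsArtinAlgebra Λ] : Prop :=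
  ∃ (m : ℕ) (X : Fin m → RightMod Λ), ∀ M : RightMod Λ, Indecomposable M →
    ∃ i, Nonempty (M ≅ X i)

/-- The (Rouquier) dimension of a triangulated category `T`: the least `d` such that some object
`M` satisfies `T = ⟨M⟩_{d+1}`, and `⊤` if there is none.  Here `⟨M⟩_{d+1}` is
`(ObjectProperty.singleton M).triangEnvelopeIter d`: the objects obtained from shifts of `M` by
finite direct sums, direct summands and at most `d` extensions. -/
noncomputable def triDim (T : Type u) [Category.{v} T] [HasZeroObject T] [HasShift T ℤ]
    [Preadditive T] [∀ n : ℤ, (shiftFunctor T n).Additive] [Pretriangulated T] : ℕ∞ :=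
  ⨅ (d : ℕ) (_ : ∃ M : T, (ObjectProperty.singleton M).triangEnvelopeIter d = ⊤), (d : ℕ∞)

/-- The derived dimension of `Λ`: the dimension of the bounded derived category of `mod Λ`. -/
noncomputable def derivedDim (Λ : Type u) [Ring Λ] [IsArtinAlgebra Λ]
    [HasDerivedCategory.{w} (RightMod Λ)] : ℕ∞ :=
  triDim (DerivedCategory.Bounded (RightMod Λ))

/-! A bounded object `X` fits into a triangle `Z ⟶ X ⟶ B ⟶ Z[1]` with `Z` and `B` finite sums of
shifts of first syzygies. They play the role of the cycles and boundaries of a projective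
resolution, but are built along finitely many truncations, so that the sums stay finite
(`exists_cycles_triangle`). Such a cone of `k`-th syzygies is, up to one extension by shifted
projectives, a cone of `(k+1)`-th syzygies (`IsSyzCone.exists_triangle`). Hence `n - 1` extensions
lead from first to `n`-th syzygies. By Schanuel's lemma any `n`-th syzygy of `M` is a summand of
`Ωⁿ(M) ⊕ P` with `P` projective (`exists_retract_of_isSyzygy`), so from the generator `Λ ⊕ V` it
costs one extension, by the Igusa–Todorov sequence. The last cone costs `1 + 1 + 1 = 3`, in total
`(n - 1) + 3 = n + 2`. For `n = 0` the cone of first syzygies is used directly, which gives `3`.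

If `rad^(2p+1) = 0`, then `Ω(M)` lies in the radical of a projective, so `rad^(2p)` kills it and it
is an extension `0 ⟶ A ⟶ Ω(M) ⟶ B ⟶ 0` of modules over `Λ/rad^p`. Lifting a projective `P ⟶ B` gives
`0 ⟶ Ω(B) ⟶ A ⊕ P ⟶ Ω(M) ⟶ 0`. As `Λ/rad^p` is representation-finite, `A`, `P` and `Ω(B)` all lie in
`add V` for one `V`. -/

/-! ### Finite sums and biproducts of distinguished triangles. -/

section FiniteSums

open Pretriangulated Triangulated

variable {T : Type u} [Category.{v} T] [HasZeroObject T] [HasShift T ℤ] [Preadditive T]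
  [∀ n : ℤ, (shiftFunctor T n).Additive] [Pretriangulated T]

/-- The objects that are isomorphic to finite (nonempty) direct sums of objects satisfying `Q`. -/
inductive FiniteSums (Q : ObjectProperty T) : T → Prop
  | of {X : T} (hX : Q X) : FiniteSums Q X
  | biprod {X Y : T} (hX : FiniteSums Q X) (hY : FiniteSums Q Y) : FiniteSums Q (X ⊞ Y)
  | iso {X Y : T} (e : X ≅ Y) (hX : FiniteSums Q X) : FiniteSums Q Y

namespace FiniteSums

variable {Q : ObjectProperty T}

lemma mono {Q' : ObjectProperty T} (h : ∀ X, Q X → Q' X) {X : T} (hX : FiniteSums Q X) :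
    FiniteSums Q' X := by
  induction hX with
  | of hX => exact .of (h _ hX)
  | biprod _ _ h₁ h₂ => exact .biprod h₁ h₂
  | iso e _ h => exact .iso e h

lemma shift (hQ : ∀ (X : T) (n : ℤ), Q X → Q (X⟦n⟧)) {X : T} (hX : FiniteSums Q X) (n : ℤ) :
    FiniteSums Q (X⟦n⟧) := by
  induction hX with
  | of hX => exact .of (hQ _ _ hX)
  | biprod _ _ h₁ h₂ => 
    have := preservesBinaryBiproducts_of_preservesBiproducts (shiftFunctor T n)
    exact .iso ((shiftFunctor T n).mapBiprod _ _).symm (.biprod h₁ h₂)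
  | iso e _ h => exact .iso ((shiftFunctor T n).mapIso e) h

lemma of_distTriang {X Y Z : T} {f : X ⟶ Y} {g : Y ⟶ Z} {h : Z ⟶ X⟦(1 : ℤ)⟧}
    (hT : Triangle.mk f g h ∈ distTriang T) (h₀ : h = 0)
    (hX : FiniteSums Q X) (hZ : FiniteSums Q Z) : FiniteSums Q Y := by
  obtain ⟨e, -, -⟩ := exists_iso_binaryBiproduct_of_distTriang _ hT h₀
  exact .iso e.symm (.biprod hX hZ)

/-- If all maps from objects satisfying `Q` are annihilated by `g`, so are all
maps from finite sums of such objects. -/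
lemma comp_eq_zero {Y Z : T} (g : Y ⟶ Z)
    (hQ : ∀ (X : T) (_ : Q X) (a : X ⟶ Y), a ≫ g = 0) {X : T} (hX : FiniteSums Q X) (a : X ⟶ Y) :
    a ≫ g = 0 := by
  induction hX with
  | of hX => exact hQ _ hX a
  | biprod _ _ h₁ h₂ =>
    apply biprod.hom_ext'
    · simpa using h₁ (biprod.inl ≫ a)
    · simpa using h₂ (biprod.inr ≫ a)
  | iso e _ h => simpa using congr(e.inv ≫ $(h (e.hom ≫ a)))

end FiniteSums

/-- The comparison of a biproduct with the product of a family of two objects. -/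
noncomputable def biprodIsoPi (X : WalkingPair → T) :
    X .left ⊞ X .right ≅ ∏ᶜ X where
  hom := Pi.lift (fun | .left => biprod.fst | .right => biprod.snd)
  inv := biprod.lift (Pi.π X .left) (Pi.π X .right)
  hom_inv_id := by apply biprod.hom_ext <;> simp
  inv_hom_id := by
    apply Pi.hom_ext
    rintro (_ | _) <;> simp

lemma biprodIsoPi_hom_π_left (X : WalkingPair → T) :
    (biprodIsoPi X).hom ≫ Pi.π X .left = biprod.fst := by
  simp [biprodIsoPi]

lemma biprodIsoPi_hom_π_right (X : WalkingPair → T) :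
    (biprodIsoPi X).hom ≫ Pi.π X .right = biprod.snd := by
  simp [biprodIsoPi]

lemma biprodIsoPi_hom_map {X Y : WalkingPair → T} (f : ∀ j, X j ⟶ Y j) :
    biprod.map (f .left) (f .right) ≫ (biprodIsoPi Y).hom =
      (biprodIsoPi X).hom ≫ Limits.Pi.map f := by
  apply Pi.hom_ext
  rintro (_ | _)
  · rw [Category.assoc, Category.assoc, biprodIsoPi_hom_π_left, Pi.map_π,
      reassoc_of% (biprodIsoPi_hom_π_left X), biprod.map_fst]
  · rw [Category.assoc, Category.assoc, biprodIsoPi_hom_π_right, Pi.map_π,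
      reassoc_of% (biprodIsoPi_hom_π_right X), biprod.map_snd]

/-- Products of distinguished triangles are distinguished, and `biprodIsoPi` transports this to
biproducts. The connecting map is never needed explicitly. -/
lemma exists_biprod_distTriang (F : WalkingPair → Triangle T) (hF : ∀ j, F j ∈ distTriang T) :
    ∃ h, Triangle.mk (biprod.map (F .left).mor₁ (F .right).mor₁)
      (biprod.map (F .left).mor₂ (F .right).mor₂) h ∈ distTriang T := by
  let e₁ := biprodIsoPi (fun j => (F j).obj₁)
  let m : ∏ᶜ (fun j => (F j).obj₃) ⟶ (∏ᶜ fun j => (F j).obj₁)⟦(1 : ℤ)⟧ := (productTriangle F).mor₃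
  refine ⟨(biprodIsoPi (fun j => (F j).obj₃)).hom ≫ m ≫ e₁.inv⟦1⟧',
    isomorphic_distinguished _ (productTriangle_distinguished F hF) _
    (Triangle.isoMk _ _ e₁ (biprodIsoPi (fun j => (F j).obj₂))
      (biprodIsoPi (fun j => (F j).obj₃)) ?_ ?_ ?_)⟩
  · exact biprodIsoPi_hom_map (fun j => (F j).mor₁)
  · exact biprodIsoPi_hom_map (fun j => (F j).mor₂)
  · change ((biprodIsoPi (fun j => (F j).obj₃)).hom ≫ m ≫ e₁.inv⟦1⟧') ≫ e₁.hom⟦1⟧' =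
      (biprodIsoPi (fun j => (F j).obj₃)).hom ≫ m
    rw [Category.assoc, Category.assoc, ← Functor.map_comp, e₁.inv_hom_id,
      CategoryTheory.Functor.map_id,
      Category.comp_id]

lemma biprod_distTriang {X Y Z X' Y' Z' : T} {f : X ⟶ Y} {g : Y ⟶ Z} {h : Z ⟶ X⟦(1 : ℤ)⟧}
    {f' : X' ⟶ Y'} {g' : Y' ⟶ Z'} {h' : Z' ⟶ X'⟦(1 : ℤ)⟧}
    (hT : Triangle.mk f g h ∈ distTriang T) (hT' : Triangle.mk f' g' h' ∈ distTriang T) :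
    ∃ h'', Triangle.mk (biprod.map f f') (biprod.map g g') h'' ∈ distTriang T :=
  exists_biprod_distTriang
    (fun j => WalkingPair.casesOn j (Triangle.mk f g h) (Triangle.mk f' g' h'))
    (by rintro (_ | _); exacts [hT, hT'])

section Triangles

variable {X Y Z : T} {f : X ⟶ Y} {g : Y ⟶ Z} {h : Z ⟶ X⟦(1 : ℤ)⟧}

lemma mk_rot_distTriang (hT : Triangle.mk f g h ∈ distTriang T) :
    Triangle.mk g h (-f⟦(1 : ℤ)⟧') ∈ distTriang T :=
  rot_of_distTriang _ hT

lemma mk_distTriang_of_rot (hT : Triangle.mk g h (-f⟦(1 : ℤ)⟧') ∈ distTriang T) :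
    Triangle.mk f g h ∈ distTriang T :=
  (rotate_distinguished_triangle _).2 hT

lemma mk_comp_zero₁₂ (hT : Triangle.mk f g h ∈ distTriang T) : f ≫ g = 0 :=
  comp_distTriang_mor_zero₁₂ _ hT

lemma mk_comp_zero₂₃ (hT : Triangle.mk f g h ∈ distTriang T) : g ≫ h = 0 :=
  comp_distTriang_mor_zero₂₃ _ hT

lemma mk_yoneda_exact₃ (hT : Triangle.mk f g h ∈ distTriang T) {W : T} (a : Z ⟶ W)
    (ha : g ≫ a = 0) : ∃ b : X⟦(1 : ℤ)⟧ ⟶ W, a = h ≫ b :=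
  Triangle.yoneda_exact₃ _ hT a ha

lemma mk_coyoneda_exact₃ (hT : Triangle.mk f g h ∈ distTriang T) {W : T} (a : W ⟶ Z)
    (ha : a ≫ h = 0) : ∃ b : W ⟶ Y, a = b ≫ g :=
  Triangle.coyoneda_exact₃ _ hT a ha

lemma mk_exists_inv_rot (hT : Triangle.mk f g h ∈ distTriang T) :
    ∃ (f' : Z⟦(-1 : ℤ)⟧ ⟶ X) (h' : Y ⟶ Z⟦(-1 : ℤ)⟧⟦(1 : ℤ)⟧),
      Triangle.mk f' f h' ∈ distTriang T :=
  ⟨_, _, inv_rot_of_distTriang _ hT⟩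

end Triangles

/-! ### Octahedral constructions. -/

section Octahedra

variable [IsTriangulated T]

/-- Splicing of two "cycles-boundaries" triangles. -/
lemma exists_splice {Y' Y H Z₀ B₀ : T} {i : Y' ⟶ Y} {u : Y ⟶ H} {d : H ⟶ Y'⟦(1 : ℤ)⟧}
    (hY : Triangle.mk i u d ∈ distTriang T) (g : Z₀ ⟶ Y) {b : H ⟶ B₀} {c : B₀ ⟶ Z₀⟦(1 : ℤ)⟧}
    (hH : Triangle.mk (g ≫ u) b c ∈ distTriang T) :
    ∃ k : B₀ ⟶ Y'⟦(1 : ℤ)⟧, ∀ {Z' B' : T} {p : Z' ⟶ Y'} {h : Y' ⟶ B'} {q : B' ⟶ Z'⟦(1 : ℤ)⟧},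
      Triangle.mk p h q ∈ distTriang T → k ≫ h⟦(1 : ℤ)⟧' = 0 →
      ∀ (Q : ObjectProperty T) (_ : ∀ (X : T) (n : ℤ), Q X → Q (X⟦n⟧)),
        FiniteSums Q Z' → FiniteSums Q B' → FiniteSums Q Z₀ → FiniteSums Q B₀ →
        ∃ (Z B : T) (p' : Z ⟶ Y) (h' : Y ⟶ B) (q' : B ⟶ Z⟦(1 : ℤ)⟧),
          Triangle.mk p' h' q' ∈ distTriang T ∧ FiniteSums Q Z ∧ FiniteSums Q B ∧
            g ≫ h' = 0 := by
  obtain ⟨C, v, w, hC⟩ := distinguished_cocone_triangle g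
  -- `m₃` is the connecting map of `Y' ⟶ C ⟶ B₀`, with `C` the cone of `g`. It is fixed before any
  -- triangle on `Y'` is chosen, so that triangle can be required to kill it.
  obtain ⟨m₁, m₃, -, -, -, -, hm⟩ :=
    someOctahedron (rfl : g ≫ u = _) hC (mk_rot_distTriang hY) hH
  refine ⟨m₃, ?_⟩
  intro Z' B' p h q hp hk Q hQ hZ' hB' hZ₀ hB₀
  rw [Preadditive.neg_comp, ← Functor.map_comp] at hm
  have h₂ := mk_distTriang_of_rot hm
  -- `D` is the new `B`: an extension of `B₀` by `B'` with connecting map `k ≫ h[1] = 0`, hence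
  -- split.
  obtain ⟨D, d, e, hD⟩ := distinguished_cocone_triangle (p ≫ i ≫ v)
  have hDS : FiniteSums Q D :=
    .of_distTriang (someOctahedron (rfl : p ≫ (i ≫ v) = _) hp h₂ hD).mem hk hB' hB₀
  -- `G` is the new `Z`, shifted by one: an extension of `Z'[1]` by `Z₀[1]`, split because its
  -- connecting map contains `v ≫ w = 0`.
  obtain ⟨G, x, y, hG⟩ := distinguished_cocone_triangle (v ≫ d)
  obtain ⟨Z, B, hZ⟩ := mk_exists_inv_rot hG
  have hvw : v ≫ w = 0 := mk_comp_zero₂₃ hC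
  have hGS : FiniteSums Q G := by
    refine .of_distTriang (someOctahedron (rfl : v ≫ d = _) (mk_rot_distTriang hC)
      (mk_rot_distTriang hD) hG).mem ?_ (hZ₀.shift hQ 1) (hZ'.shift hQ 1)
    rw [Preadditive.neg_comp, ← Functor.map_comp, Category.assoc, Category.assoc, hvw]
    simp
  exact ⟨_, _, _, _, _, hZ, hGS.shift hQ _, hDS, by
    rw [← Category.assoc, mk_comp_zero₁₂ hC, zero_comp]⟩

/-- Replacing the two outer terms of a triangle by the cones of maps onto them. -/
lemma exists_syzygy_triangle {Z X B P L P' L' : T} {p : Z ⟶ X} {h : X ⟶ B}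
    {q : B ⟶ Z⟦(1 : ℤ)⟧} (hT : Triangle.mk p h q ∈ distTriang T)
    {a : P ⟶ Z} {b : Z ⟶ L} {c : L ⟶ P⟦(1 : ℤ)⟧} (hL : Triangle.mk a b c ∈ distTriang T)
    {a' : P' ⟶ B} {b' : B ⟶ L'} {c' : L' ⟶ P'⟦(1 : ℤ)⟧}
    (hL' : Triangle.mk a' b' c' ∈ distTriang T) (h₀ : a' ≫ q ≫ b⟦(1 : ℤ)⟧' = 0)
    (Q : ObjectProperty T) (hQ : ∀ (X : T) (n : ℤ), Q X → Q (X⟦n⟧))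
    (hP'Q : FiniteSums Q P') (hLQ : FiniteSums Q L) :
    ∃ (Y : T) (s : P ⟶ X) (t : X ⟶ Y) (r : Y ⟶ P⟦(1 : ℤ)⟧) (G : T) (x : G ⟶ Y) (y : Y ⟶ L')
      (z : L' ⟶ G⟦(1 : ℤ)⟧),
      Triangle.mk s t r ∈ distTriang T ∧ Triangle.mk x y z ∈ distTriang T ∧
        FiniteSums Q G := by
  obtain ⟨Y, t, r, hY⟩ := distinguished_cocone_triangle (a ≫ p)
  obtain ⟨m₁, m₃, -, -, -, -, hm⟩ := someOctahedron (rfl : a ≫ p = _) hL hT hY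
  -- `Y` is an extension of `B` by `L` with connecting map `q ≫ b[1]`. The hypothesis `h₀` says that
  -- this vanishes on `P'`, so `G` splits as `L[1] ⊞ P'[1]`.
  obtain ⟨G, x, y, hG⟩ := distinguished_cocone_triangle (m₃ ≫ b')
  obtain ⟨_, _, hZ⟩ := mk_exists_inv_rot hG
  refine ⟨Y, _, t, r, _, _, _, _, hY, hZ, .shift hQ (.of_distTriang (someOctahedron
    (rfl : m₃ ≫ b' = _) (mk_rot_distTriang hm) (mk_rot_distTriang hL') hG).mem ?_
    (hLQ.shift hQ 1) (hP'Q.shift hQ 1)) _⟩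
  rw [Preadditive.neg_comp, ← Functor.map_comp, h₀]
  simp

end Octahedra

end FiniteSums

/-! ### Syzygies that need not be minimal. -/

section Syzygies

variable {C : Type u} [Category.{v} C] [Abelian C]

/-- `Syz k M L`: `L` is a (not necessarily minimal) `k`-th syzygy of `M`. -/
def Syz : ℕ → C → C → Prop
  | 0, M, L => Nonempty (L ≅ M)
  | k + 1, M, L => ∃ (P W : C) (i : L ⟶ P) (p : P ⟶ W) (h : i ≫ p = 0),
      (ShortComplex.mk i p h).ShortExact ∧ Projective P ∧ Syz k M W

/-- `L` is a `k`-th syzygy of some object. -/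
def IsSyz (k : ℕ) : ObjectProperty C := fun L => ∃ M, Syz k M L

lemma shortExact_kernel {X Y : C} (p : X ⟶ Y) [Epi p] :
    (ShortComplex.mk (kernel.ι p) p (kernel.condition p)).ShortExact where
  exact := ShortComplex.exact_of_f_is_kernel _ (kernelIsKernel p)

lemma shortExact_cokernel {X Y : C} (i : X ⟶ Y) [Mono i] :
    (ShortComplex.mk i (cokernel.π i) (cokernel.condition i)).ShortExact where
  exact := ShortComplex.exact_of_g_is_cokernel _ (cokernelIsCokernel i)

lemma isSyz_succ_of_shortExact {k : ℕ} {S : ShortComplex C} (hS : S.ShortExact)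
    (h₂ : Projective S.X₂) (h₃ : IsSyz k S.X₃) : IsSyz (k + 1) S.X₁ := by
  obtain ⟨M, hM⟩ := h₃
  exact ⟨M, S.X₂, S.X₃, S.f, S.g, S.zero, hS, h₂, hM⟩

lemma isSyz_one_of_mono {L P : C} (i : L ⟶ P) [Mono i] (hP : Projective P) : IsSyz 1 L :=
  isSyz_succ_of_shortExact (shortExact_cokernel i) hP ⟨_, ⟨Iso.refl _⟩⟩

lemma isSyz_of_projective (k : ℕ) {P : C} (hP : Projective P) : IsSyz k P := by
  induction k generalizing P with
  | zero => exact ⟨P, ⟨Iso.refl _⟩⟩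
  | succ k ih =>
    exact isSyz_succ_of_shortExact (shortExact_cokernel (𝟙 P)) hP
      (ih (Projective.of_iso (cokernel.ofEpi (𝟙 P)).symm inferInstance))

end Syzygies

/-! ### Stalk complexes in the derived category. -/

section Derived

open Pretriangulated Triangulated DerivedCategory

variable {C : Type u} [Category.{v} C] [Abelian C] [HasDerivedCategory.{w} C]

/-- A projective stalk is K-projective, so `f` comes from a chain map into a complex that is zero in
degrees above `m`; in degree `i` there is nothing to hit. -/
lemma hom_single_eq_zero_of_projective {P : C} [Projective P] {i m : ℤ} (him : m < i)
    {Y : DerivedCategory C} (hY : Y.IsLE m) (f : (singleFunctor C i).obj P ⟶ Y) : f = 0 := by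
  obtain ⟨K, hK, ⟨e⟩⟩ := Y.exists_iso_Q_obj_of_isLE m
  have : ∀ n, Projective (((CochainComplex.singleFunctor C i).obj P).X n) := by
    intro n
    by_cases hn : n = i
    · subst hn
      exact Projective.of_iso (HomologicalComplex.singleObjXSelf (.up ℤ) n P).symm inferInstance
    · exact Projective.of_iso
        (HomologicalComplex.isZero_single_obj_X (.up ℤ) i P n hn).isoZero.symm inferInstance
  have hP : ((CochainComplex.singleFunctor C i).obj P).IsKProjective :=
    CochainComplex.isKProjective_of_projective _ i
  rw [← cancel_mono e.hom, zero_comp]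
  obtain ⟨g, hg⟩ := (CochainComplex.IsKProjective.Qh_map_bijective
    ((CochainComplex.singleFunctor C i).obj P) ((HomotopyCategory.quotient _ _).obj K)).surjective
      (f ≫ e.hom)
  obtain ⟨g, rfl⟩ := (HomotopyCategory.quotient _ _).map_surjective g
  have : g = 0 := by
    ext n
    by_cases hn : n = i
    · subst hn
      exact (K.isZero_of_isStrictlyLE m n him).eq_of_tgt _ _
    · exact (HomologicalComplex.isZero_single_obj_X (.up ℤ) i P n hn).eq_of_src _ _
  rw [this, Functor.map_zero, Functor.map_zero] at hg
  exact hg.symm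

lemma exists_single_distTriang {S : ShortComplex C} (hS : S.ShortExact) (n : ℤ) :
    ∃ h, Triangle.mk ((singleFunctor C n).map S.f) ((singleFunctor C n).map S.g) h ∈
      distTriang (DerivedCategory C) :=
  ⟨_, triangleOfSES_distinguished (hS.map_of_exact (HomologicalComplex.single C (.up ℤ) n))⟩

lemma exists_single_kernel_distTriang {X Y : C} (p : X ⟶ Y) [Epi p] (n : ℤ) :
    ∃ h : (singleFunctor C n).obj Y ⟶ ((singleFunctor C n).obj (kernel p))⟦(1 : ℤ)⟧,
      Triangle.mk ((singleFunctor C n).map (kernel.ι p)) ((singleFunctor C n).map p) h ∈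
        distTriang (DerivedCategory C) :=
  exists_single_distTriang (shortExact_kernel p) n

/-- The isomorphism `M[-n][a] ≅ M[-n']`. -/
noncomputable def shiftSingleIso (X : C) (a n n' : ℤ) (h : a + n' = n) :
    ((singleFunctor C n).obj X)⟦a⟧ ≅ (singleFunctor C n').obj X :=
  ((singleFunctors C).shiftIso a n' n h).app X

/-- The shifts of objects of `C` satisfying `W`. -/
def Stalk (W : ObjectProperty C) : ObjectProperty (DerivedCategory C) := fun X =>
  ∃ (M : C) (n : ℤ), W M ∧ Nonempty (X ≅ (singleFunctor C n).obj M)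

lemma Stalk.single {W : ObjectProperty C} {M : C} (h : W M) (n : ℤ) :
    Stalk W ((singleFunctor C n).obj M) := ⟨M, n, h, ⟨Iso.refl _⟩⟩

lemma Stalk.mono {W W' : ObjectProperty C} (h : ∀ M, W M → W' M) (X : DerivedCategory C)
    (hX : Stalk W X) : Stalk W' X := by
  obtain ⟨M, n, hM, e⟩ := hX
  exact ⟨M, n, h _ hM, e⟩

lemma Stalk.shift {W : ObjectProperty C} (X : DerivedCategory C) (a : ℤ) (hX : Stalk W X) :
    Stalk W (X⟦a⟧) := by
  obtain ⟨M, n, hM, ⟨e⟩⟩ := hX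
  exact ⟨M, n - a, hM, ⟨(shiftFunctor _ a).mapIso e ≪≫ shiftSingleIso M a n (n - a) (by lia)⟩⟩

end Derived

/-! ### Passing from `k`-th to `(k+1)`-th syzygies. -/

section Resolution

open Pretriangulated Triangulated DerivedCategory

section

variable {T : Type u} [Category.{v} T] [HasZeroObject T] [HasShift T ℤ] [Preadditive T]
  [∀ n : ℤ, (shiftFunctor T n).Additive] [Pretriangulated T]

lemma eq_zero_of_comp_shift_biprod {X Y Z : T} (n : ℤ) (f : X ⟶ (Y ⊞ Z)⟦n⟧)
    (h₁ : f ≫ (biprod.fst : Y ⊞ Z ⟶ Y)⟦n⟧' = 0) (h₂ : f ≫ (biprod.snd : Y ⊞ Z ⟶ Z)⟦n⟧' = 0) :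
    f = 0 := by
  rw [← Category.comp_id f, ← CategoryTheory.Functor.map_id, ← biprod.total, Functor.map_add,
    Functor.map_comp, Functor.map_comp, Preadditive.comp_add, reassoc_of% h₁, reassoc_of% h₂]
  simp

lemma mk_distTriang_of_iso₂ {X Y Z Y' : T} {f : X ⟶ Y} {g : Y ⟶ Z} {h : Z ⟶ X⟦(1 : ℤ)⟧}
    (hT : Triangle.mk f g h ∈ distTriang T) (e : Y ≅ Y') :
    Triangle.mk (f ≫ e.hom) (e.inv ≫ g) h ∈ distTriang T := by
  refine isomorphic_distinguished _ hT _
    (Triangle.isoMk _ _ (Iso.refl _) e.symm (Iso.refl _) ?_ ?_ ?_)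
  · change (f ≫ e.hom) ≫ e.inv = 𝟙 _ ≫ f
    simp
  · change (e.inv ≫ g) ≫ 𝟙 _ = e.inv ≫ g
    simp
  · change h ≫ (𝟙 X)⟦(1 : ℤ)⟧' = 𝟙 _ ≫ h
    simp

end

variable {C : Type u} [Category.{v} C] [Abelian C] [HasDerivedCategory.{w} C]
  [EnoughProjectives C]

/-- Stalkwise this is the rotated triangle `P ⟶ W ⟶ Ω(W)[1]`. The final clause provides the
hypothesis `h₀` of `exists_syzygy_triangle`. -/
lemma exists_projective_triangle {k : ℕ} {Z : DerivedCategory C}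
    (hZ : FiniteSums (Stalk (IsSyz k)) Z) :
    ∃ (P L : DerivedCategory C) (a : P ⟶ Z) (b : Z ⟶ L) (c : L ⟶ P⟦(1 : ℤ)⟧),
      Triangle.mk a b c ∈ distTriang _ ∧ FiniteSums (Stalk (fun P : C => Projective P)) P ∧
      FiniteSums (Stalk (IsSyz (k + 1))) L ∧
      ∀ (P' : DerivedCategory C) (_ : FiniteSums (Stalk (fun P : C => Projective P)) P')
        (f : P' ⟶ Z⟦(1 : ℤ)⟧), f ≫ b⟦(1 : ℤ)⟧' = 0 := by
  induction hZ with
  | @of X hX =>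
    obtain ⟨W, j, hW, ⟨e⟩⟩ := hX
    have hS := shortExact_kernel (Projective.π W)
    obtain ⟨h, hT⟩ := exists_single_distTriang hS j
    have hT' := mk_distTriang_of_iso₂ (mk_rot_distTriang hT) e.symm
    refine ⟨_, _, _, _, _, hT', .of (.single (W := fun P : C => Projective P)
      (Projective.projective_over W) j),
      .of (.shift _ _ (.single (isSyz_succ_of_shortExact hS (Projective.projective_over W) hW) j)),
      fun P' hP' f => FiniteSums.comp_eq_zero _ ?_ hP' f⟩
    rintro P' ⟨P, i, hP, ⟨e'⟩⟩ f
    rw [Functor.map_comp]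
    suffices ∀ (f : (singleFunctor C i).obj P ⟶ ((singleFunctor C j).obj W)⟦(1 : ℤ)⟧),
        f ≫ h⟦(1 : ℤ)⟧' = 0 by
      have := this (e'.inv ≫ f ≫ e.hom⟦(1 : ℤ)⟧')
      rw [← cancel_epi e'.inv]
      simpa using this
    intro f
    have h₁ : IsLE (((singleFunctor C j).obj W)⟦(1 : ℤ)⟧) (j - 1) :=
      TStructure.t.isLE_shift _ j 1 (j - 1)
    have h₂ : IsGE (((singleFunctor C j).obj W)⟦(1 : ℤ)⟧) (j - 1) :=
      TStructure.t.isGE_shift _ j 1 (j - 1)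
    have h₃ : IsLE (((singleFunctor C j).obj (kernel (Projective.π W)))⟦(1 : ℤ)⟧⟦(1 : ℤ)⟧)
        (j - 2) := by
      have : IsLE (((singleFunctor C j).obj (kernel (Projective.π W)))⟦(1 : ℤ)⟧) (j - 1) :=
        TStructure.t.isLE_shift _ j 1 (j - 1)
      exact TStructure.t.isLE_shift _ (j - 1) 1 (j - 2)
    -- `W[1]` sits in degree `j - 1` and `Ω(W)[2]` in degree `j - 2`. For `i < j - 1` already `f` is
    -- zero by the t-structure; otherwise `i > j - 2` and projectivity kills the composite.
    obtain hij | hij := lt_or_ge i (j - 1)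
    · rw [TStructure.t.zero f i (j - 1) hij, zero_comp]
    · exact hom_single_eq_zero_of_projective (show j - 2 < i by lia) h₃ _
  | biprod _ _ ih₁ ih₂ =>
    obtain ⟨P₁, L₁, a₁, b₁, c₁, hT₁, hP₁, hL₁, h₁⟩ := ih₁
    obtain ⟨P₂, L₂, a₂, b₂, c₂, hT₂, hP₂, hL₂, h₂⟩ := ih₂
    obtain ⟨c, hT⟩ := biprod_distTriang hT₁ hT₂
    refine ⟨_, _, _, _, _, hT, .biprod hP₁ hP₂, .biprod hL₁ hL₂, fun P' hP' f => ?_⟩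
    apply eq_zero_of_comp_shift_biprod
    · rw [Category.assoc, ← Functor.map_comp, biprod.map_fst, Functor.map_comp, ← Category.assoc,
        h₁ P' hP']
    · rw [Category.assoc, ← Functor.map_comp, biprod.map_snd, Functor.map_comp, ← Category.assoc,
        h₂ P' hP']
  | iso e _ ih =>
    obtain ⟨P, L, a, b, c, hT, hP, hL, h⟩ := ih
    refine ⟨_, _, _, _, _, mk_distTriang_of_iso₂ hT e, hP, hL, fun P' hP' f => ?_⟩
    rw [Functor.map_comp, ← Category.assoc, h P' hP']

/-- Objects that are cones of morphisms between finite sums of shifts of `k`-th syzygies. -/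
def IsSyzCone (k : ℕ) : ObjectProperty (DerivedCategory C) := fun X =>
  ∃ (Z B : DerivedCategory C) (p : Z ⟶ X) (h : X ⟶ B) (q : B ⟶ Z⟦(1 : ℤ)⟧),
    Triangle.mk p h q ∈ distTriang _ ∧ FiniteSums (Stalk (IsSyz k)) Z ∧
      FiniteSums (Stalk (IsSyz k)) B

/-- The new cone has outer terms `L ⊞ P'` and `L'`; the stray projective summand `P'` does no harm,
since projectives are syzygies of every order. -/
lemma IsSyzCone.exists_triangle {k : ℕ} {X : DerivedCategory C} (hX : IsSyzCone k X) :
    ∃ (P Y : DerivedCategory C) (s : P ⟶ X) (t : X ⟶ Y) (r : Y ⟶ P⟦(1 : ℤ)⟧),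
      Triangle.mk s t r ∈ distTriang _ ∧ FiniteSums (Stalk (fun P : C => Projective P)) P ∧
        IsSyzCone (k + 1) Y := by
  obtain ⟨Z, B, p, h, q, hT, hZ, hB⟩ := hX
  obtain ⟨P, L, a, b, c, hL, hP, hL', hz⟩ := exists_projective_triangle hZ
  obtain ⟨P', L', a', b', c', hL₂, hP', hL₂', -⟩ := exists_projective_triangle hB
  obtain ⟨Y, s, t, r, G, x, y, z, h₁, h₂, h₃⟩ := exists_syzygy_triangle hT hL hL₂
    (by rw [← Category.assoc]; exact hz _ hP' _) (Stalk (IsSyz (k + 1))) Stalk.shift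
    (hP'.mono (Stalk.mono fun P hP => isSyz_of_projective _ hP)) hL'
  exact ⟨P, Y, s, t, r, h₁, hP, G, L', x, y, z, h₂, h₃, hL₂'⟩

end Resolution

/-! ### Cycles and boundaries of a bounded object. -/

section Cycles

open Pretriangulated Triangulated DerivedCategory ZeroObject

variable {C : Type u} [Category.{v} C] [Abelian C] [EnoughProjectives C]

/-- Both objects embed into the projective `Projective.over N ⊞ P`, whatever `ζ` is. -/
lemma isSyz_one_biprod_kernel (N P : C) [Projective P] {H : C}
    (ζ : kernel (Projective.π N) ⊞ P ⟶ H) :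
    IsSyz 1 (kernel (Projective.π N) ⊞ P) ∧ IsSyz 1 (kernel ζ) := by
  let j : kernel (Projective.π N) ⊞ P ⟶ Projective.over N ⊞ P :=
    biprod.map (kernel.ι _) (𝟙 P)
  exact ⟨isSyz_one_of_mono j inferInstance, isSyz_one_of_mono (kernel.ι ζ ≫ j) inferInstance⟩

variable [HasDerivedCategory.{w} C]

/-- A bounded object of the derived category is an extension of two finite sums of shifts of
syzygies, the quotient of which can be made to annihilate a given map. -/
lemma exists_cycles_triangle (m : ℕ) (a c : ℤ) (hc : c = a + m - 1) (Y : DerivedCategory C)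
    (hYa : Y.IsGE a) (hYc : Y.IsLE c) (N : C) (f : (singleFunctor C c).obj N ⟶ Y⟦(1 : ℤ)⟧) :
    ∃ (Z B : DerivedCategory C) (p : Z ⟶ Y) (h : Y ⟶ B) (q : B ⟶ Z⟦(1 : ℤ)⟧),
      Triangle.mk p h q ∈ distTriang _ ∧ FiniteSums (Stalk (IsSyz 1)) Z ∧
        FiniteSums (Stalk (IsSyz 1)) B ∧ f ≫ h⟦(1 : ℤ)⟧' = 0 := by
  -- `m` counts the degrees from `a` to `c`. The map `f` strengthens the induction: at the next
  -- stage it is the map `k` of `exists_splice`, which has to be annihilated.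
  induction m generalizing c Y N with
  | zero =>
    have hY : IsZero Y := TStructure.t.isZero Y c a (by simp [hc])
    -- `FiniteSums` has no empty sum, so zero is realised as the stalk of the zero object, which is
    -- projective.
    have h₀ : IsZero ((singleFunctor C 0).obj (0 : C)) :=
      Functor.map_isZero _ (isZero_zero C)
    have hS : FiniteSums (Stalk (IsSyz 1)) ((singleFunctor C 0).obj (0 : C)) :=
      .of (.single (isSyz_of_projective 1 inferInstance) 0)
    exact ⟨Y, 0, _, _, _, contractible_distinguished Y, .iso (h₀.iso hY) hS,
      .iso (h₀.iso (isZero_zero _)) hS, by simp⟩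
  | succ m ih =>
    have hY₁ : IsLE (Y⟦(1 : ℤ)⟧) (c - 1) := TStructure.t.isLE_shift _ c 1 (c - 1)
    obtain ⟨δ, hδ⟩ := exists_single_kernel_distTriang (Projective.π N) c
    -- Since `Y[1]` lives in degrees at most `c - 1`, `f` vanishes on the projective over `N` and
    -- factors through `Ω(N)[1]`. Killing `f` is thus reduced to killing `g₀`, defined on `Ω(N)` in
    -- degree `c`.
    obtain ⟨g', hg'⟩ := mk_yoneda_exact₃ hδ f
      (hom_single_eq_zero_of_projective (show c - 1 < c by lia) hY₁ _)
    obtain ⟨g₀, rfl⟩ := (shiftFunctor (DerivedCategory C) (1 : ℤ)).map_surjective g'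
    obtain ⟨Y', H', hY'c, hH'c, i, u, d, hT⟩ := TStructure.t.exists_triangle Y (c - 1) c (by lia)
    replace hY'c : IsLE Y' (c - 1) := ⟨hY'c⟩
    replace hH'c : IsGE H' c := ⟨hH'c⟩
    have hY'₁ : IsLE (Y'⟦(1 : ℤ)⟧) (c - 2) := TStructure.t.isLE_shift _ (c - 1) 1 (c - 2)
    have hH'c' : IsLE H' c := TStructure.t.isLE₂ _ (mk_rot_distTriang hT) c hYc
      (TStructure.t.isLE_of_le (Y'⟦(1 : ℤ)⟧) (c - 2) c)
    have hY'a : IsGE Y' a := by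
      obtain ⟨_, _, hT'⟩ := mk_exists_inv_rot hT
      have : IsGE (H'⟦(-1 : ℤ)⟧) (c + 1) := TStructure.t.isGE_shift _ c (-1) (c + 1)
      exact TStructure.t.isGE₂ _ hT' a (TStructure.t.isGE_of_ge (H'⟦(-1 : ℤ)⟧) a (c + 1)) hYa
    obtain ⟨H, ⟨e⟩⟩ := exists_iso_singleFunctor_obj_of_isGE_of_isLE H' c
    -- The projective over the top cohomology `H` lifts to `Y`, because it has no maps to `Y'[1]`.
    obtain ⟨l, hl⟩ := mk_coyoneda_exact₃ hT
      ((singleFunctor C c).map (Projective.π H) ≫ e.inv)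
      (hom_single_eq_zero_of_projective (show c - 2 < c by lia) hY'₁ _)
    obtain ⟨z, hz⟩ := (singleFunctor C c).map_surjective (g₀ ≫ u ≫ e.hom)
    replace hl : l ≫ u = (singleFunctor C c).map (Projective.π H) ≫ e.inv := hl.symm
    let ζ : kernel (Projective.π N) ⊞ Projective.over H ⟶ H := biprod.desc z (Projective.π H)
    -- The top-degree cycles: `l` makes `ζ` epi, and including `g₀` forces the final `h` to kill it.
    let g : (singleFunctor C c).obj (kernel (Projective.π N) ⊞ Projective.over H) ⟶ Y :=
      (singleFunctor C c).map biprod.fst ≫ g₀ + (singleFunctor C c).map biprod.snd ≫ l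
    have hg : g ≫ u = (singleFunctor C c).map ζ ≫ e.inv := by
      have : ζ = biprod.fst ≫ z + biprod.snd ≫ Projective.π H := by
        apply biprod.hom_ext' <;> simp [ζ]
      rw [this, Functor.map_add, Functor.map_comp, Functor.map_comp, hz]
      simp [g, hl]
    have : Epi ζ := epi_of_epi_fac (show biprod.inr ≫ ζ = Projective.π H by simp [ζ])
    obtain ⟨δ', hδ'⟩ := exists_single_kernel_distTriang ζ c
    have hT' := mk_distTriang_of_iso₂ (mk_rot_distTriang hδ') e.symm
    obtain ⟨k, hk⟩ := exists_splice hT g (by rw [hg]; exact hT')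
    -- `B₀` is `kernel ζ` placed in degree `c - 1`, the top degree allowed for `Y'`, so the
    -- induction hypothesis applies to `k`.
    let s := shiftSingleIso (kernel ζ) 1 c (c - 1) (by lia)
    obtain ⟨Z', B', p', h', q', hT'', hZ', hB', hk'⟩ :=
      ih (c - 1) (by push_cast at hc; lia) Y' hY'a hY'c (kernel ζ) (s.inv ≫ k)
    have hsyz := isSyz_one_biprod_kernel N (Projective.over H) ζ
    obtain ⟨Z, B, p, h, q, hT₃, hZ, hB, hgh⟩ := hk hT''
      (by rwa [← cancel_epi s.inv, comp_zero, ← Category.assoc]) (Stalk (IsSyz 1)) Stalk.shift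
      hZ' hB'
      (.of (.single hsyz.1 c)) (.of (.shift _ _ (.single hsyz.2 c)))
    refine ⟨Z, B, p, h, q, hT₃, hZ, hB, ?_⟩
    have hg₀ : g₀ ≫ h = 0 := by
      have : (singleFunctor C c).map biprod.inl ≫ g = g₀ := by
        simp [g, ← Functor.map_comp_assoc]
      rw [← this, Category.assoc, hgh, comp_zero]
    rw [hg']
    rw [Category.assoc, ← Functor.map_comp, hg₀, Functor.map_zero, comp_zero]

lemma isSyzCone_one_of_bounded (X : DerivedCategory C)
    (hX : (TStructure.t : TStructure (DerivedCategory C)).bounded X) : IsSyzCone 1 X := by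
  obtain ⟨⟨a, ha⟩, ⟨b, hb⟩⟩ := hX
  -- The minimum keeps the number of degrees nonnegative even if `b < a`.
  have h₁ : IsGE X (min a b) := TStructure.t.isGE_of_ge X (min a b) a (min_le_left _ _)
  obtain ⟨m, hm⟩ := Int.eq_ofNat_of_zero_le (show 0 ≤ b + 1 - min a b by lia)
  obtain ⟨Z, B, p, h, q, hT, hZ, hB, -⟩ :=
    exists_cycles_triangle m (min a b) b (by lia) X h₁ hb 0 0
  exact ⟨Z, B, p, h, q, hT, hZ, hB⟩

end Cycles

/-! ### Counting extensions in a triangulated category. -/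

section Envelope

open Pretriangulated Triangulated ObjectProperty

/-- The biproduct of two retracts. -/
noncomputable def retractBiprod {T : Type u} [Category.{v} T] [Preadditive T]
    [HasBinaryBiproducts T] {X X' Y Y' : T} (r : Retract X X') (s : Retract Y Y') :
    Retract (X ⊞ Y) (X' ⊞ Y') where
  i := biprod.map r.i s.i
  r := biprod.map r.r s.r
  retract := by apply biprod.hom_ext' <;> simp

variable {T : Type u} [Category.{v} T] [HasZeroObject T] [HasShift T ℤ] [Preadditive T]
  [∀ n : ℤ, (shiftFunctor T n).Additive] [Pretriangulated T]

lemma binaryProductsClosure_biprod (P : ObjectProperty T) {X Y : T}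
    (hX : P.binaryProductsClosure X) (hY : P.binaryProductsClosure Y) :
    P.binaryProductsClosure (X ⊞ Y) := by
  refine prop_of_iso _ (biprod.isoProd X Y).symm ?_
  exact prop_limit _ _ (by rintro ⟨_ | _⟩; exacts [hX, hY])

lemma triangEnvelopeIter_biprod (P : ObjectProperty T) (d : ℕ) {X Y : T}
    (hX : P.triangEnvelopeIter d X) (hY : P.triangEnvelopeIter d Y) :
    P.triangEnvelopeIter d (X ⊞ Y) := by
  have h₀ : ∀ {X Y : T}, (P.shiftClosure ℤ).binaryProductsClosure.retractClosure X →
      (P.shiftClosure ℤ).binaryProductsClosure.retractClosure Y →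
      (P.shiftClosure ℤ).binaryProductsClosure.retractClosure (X ⊞ Y) := by
    rintro X Y ⟨X', hX', ⟨r⟩⟩ ⟨Y', hY', ⟨s⟩⟩
    exact ⟨_, binaryProductsClosure_biprod _ hX' hY', ⟨retractBiprod r s⟩⟩
  induction d generalizing X Y with
  | zero =>
    rw [triangEnvelopeIter_zero] at hX hY ⊢
    exact h₀ hX hY
  | succ d ih =>
    rw [triangEnvelopeIter_succ] at hX hY ⊢
    obtain ⟨X', ⟨A, B, f, g, h, hT, hA, hB⟩, ⟨r⟩⟩ := hX
    obtain ⟨Y', ⟨A', B', f', g', h', hT', hA', hB'⟩, ⟨s⟩⟩ := hY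
    obtain ⟨h'', hT''⟩ := biprod_distTriang hT hT'
    exact ⟨_, ⟨_, _, _, _, _, hT'', h₀ hA hA', ih hB hB'⟩, ⟨retractBiprod r s⟩⟩

lemma triangEnvelopeIter_of_distTriang [IsTriangulated T] (P : ObjectProperty T) (d e : ℕ)
    {X Y Z : T} {f : X ⟶ Y} {g : Y ⟶ Z} {h : Z ⟶ X⟦(1 : ℤ)⟧}
    (hT : Triangle.mk f g h ∈ distTriang T) (hX : P.triangEnvelopeIter d X)
    (hZ : P.triangEnvelopeIter e Z) : P.triangEnvelopeIter (d + e + 1) Y := by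
  rw [add_assoc, triangEnvelopeIter_add' P rfl]
  exact le_retractClosure _ _ ⟨_, _, _, _, _, hT, hX, hZ⟩

end Envelope

/-! ### Counting extensions in the bounded derived category. -/

section BoundedEnvelope

open Pretriangulated Triangulated ObjectProperty DerivedCategory

variable {C : Type u} [Category.{v} C] [Abelian C] [HasDerivedCategory.{w} C]

/-- `InEnvelope M d X`: the object `X` is bounded and obtained from the bounded object `M`
in at most `d` extensions, up to shifts, finite direct sums and direct summands. -/
def InEnvelope (M : Bounded C) (d : ℕ) : ObjectProperty (DerivedCategory C) := fun X =>
  ∃ h : TStructure.t.bounded X, (singleton M).triangEnvelopeIter d ⟨X, h⟩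

variable {M : Bounded C} {d e : ℕ} {X Y Z : DerivedCategory C}

lemma bounded_of_retract (r : Retract X Y)
    (hY : (TStructure.t : TStructure (DerivedCategory C)).bounded Y) :
    (TStructure.t : TStructure (DerivedCategory C)).bounded X := by
  obtain ⟨⟨a, ha⟩, ⟨b, hb⟩⟩ := hY
  have h (i : ℤ) (hY : IsZero ((homologyFunctor C i).obj Y)) :
      IsZero ((homologyFunctor C i).obj X) := by
    rw [IsZero.iff_id_eq_zero]
    have := (r.map (homologyFunctor C i)).retract
    rw [← this, hY.eq_of_tgt (r.map (homologyFunctor C i)).i 0, zero_comp]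
  exact ⟨⟨a, (isGE_iff X a).2 fun i hi => h i (isZero_of_isGE Y a i hi)⟩,
    ⟨b, (isLE_iff X b).2 fun i hi => h i (isZero_of_isLE Y b i hi)⟩⟩

lemma InEnvelope.retract (hY : InEnvelope M d Y) (r : Retract X Y) : InEnvelope M d X := by
  obtain ⟨hb, hY⟩ := hY
  refine ⟨bounded_of_retract r hb, prop_of_retract _ ?_ hY⟩
  exact ⟨⟨r.i⟩, ⟨r.r⟩, by ext; exact r.retract⟩

lemma InEnvelope.iso (hY : InEnvelope M d Y) (e : X ≅ Y) : InEnvelope M d X :=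
  hY.retract (Retract.ofIso e)

lemma InEnvelope.shift (hX : InEnvelope M d X) (n : ℤ) : InEnvelope M d (X⟦n⟧) := by
  obtain ⟨hb, hX⟩ := hX
  have : InEnvelope M d (Bounded.ι.obj ((⟨X, hb⟩ : Bounded C)⟦n⟧)) := ⟨_, le_shift _ n _ hX⟩
  exact this.iso ((Bounded.ι.commShiftIso n).app ⟨X, hb⟩).symm

lemma InEnvelope.biprod (hX : InEnvelope M d X) (hY : InEnvelope M d Y) :
    InEnvelope M d (X ⊞ Y) := by
  obtain ⟨hbX, hX⟩ := hX
  obtain ⟨hbY, hY⟩ := hY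
  have := preservesBinaryBiproducts_of_preservesBiproducts (Bounded.ι (C := C))
  have : InEnvelope M d (Bounded.ι.obj ((⟨X, hbX⟩ : Bounded C) ⊞ ⟨Y, hbY⟩)) :=
    ⟨_, triangEnvelopeIter_biprod _ d hX hY⟩
  exact this.iso (Functor.mapBiprod Bounded.ι (⟨X, hbX⟩ : Bounded C) ⟨Y, hbY⟩).symm

lemma InEnvelope.of_distTriang {f : X ⟶ Y} {g : Y ⟶ Z} {h : Z ⟶ X⟦(1 : ℤ)⟧}
    (hT : Triangle.mk f g h ∈ distTriang _) (hX : InEnvelope M d X) (hZ : InEnvelope M e Z) :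
    InEnvelope M (d + e + 1) Y := by
  obtain ⟨hbX, hX⟩ := hX
  obtain ⟨hbZ, hZ⟩ := hZ
  have hbY := ext_of_isTriangulatedClosed₂ _ _ hT hbX hbZ
  let c := (Bounded.ι (C := C)).commShiftIso (1 : ℤ)
  let h' : (⟨Z, hbZ⟩ : Bounded C) ⟶ (⟨X, hbX⟩ : Bounded C)⟦(1 : ℤ)⟧ :=
    (fullyFaithfulι _).preimage (h ≫ c.inv.app ⟨X, hbX⟩)
  refine ⟨hbY, triangEnvelopeIter_of_distTriang _ d e (X := ⟨X, hbX⟩) (Z := ⟨Z, hbZ⟩)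
    (f := ⟨f⟩) (g := ⟨g⟩) (h := h') ?_ hX hZ⟩
  refine isomorphic_distinguished _ hT _ (Triangle.isoMk _ _ (Iso.refl _) (Iso.refl _)
    (Iso.refl _) ?_ ?_ ?_)
  · change f ≫ 𝟙 Y = 𝟙 X ≫ f
    simp
  · change g ≫ 𝟙 Z = 𝟙 Y ≫ g
    simp
  · change ((h ≫ c.inv.app ⟨X, hbX⟩) ≫ c.hom.app ⟨X, hbX⟩) ≫ (𝟙 X)⟦(1 : ℤ)⟧' = 𝟙 Z ≫ h
    rw [Category.assoc h, Iso.inv_hom_id_app]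
    change (h ≫ 𝟙 (X⟦(1 : ℤ)⟧)) ≫ (𝟙 X)⟦(1 : ℤ)⟧' = 𝟙 Z ≫ h
    simp

lemma InEnvelope.mono (hde : d ≤ e) (hX : InEnvelope M d X) : InEnvelope M e X := by
  obtain ⟨hb, hX⟩ := hX
  exact ⟨hb, monotone'_triangEnvelopeIter _ hde _ hX⟩

lemma InEnvelope.self (M : Bounded C) : InEnvelope M 0 M.obj :=
  ⟨M.property, le_triangEnvelopeIter _ 0 _ (by simp)⟩

lemma InEnvelope.finiteSums {Q : ObjectProperty (DerivedCategory C)}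
    (hQ : ∀ X, Q X → InEnvelope M d X) (hX : FiniteSums Q X) : InEnvelope M d X := by
  induction hX with
  | of hX => exact hQ _ hX
  | biprod _ _ h₁ h₂ => exact h₁.biprod h₂
  | iso e _ h => exact h.iso e.symm

lemma InEnvelope.single {N : C} (h : InEnvelope M d ((singleFunctor C 0).obj N)) (n : ℤ) :
    InEnvelope M d ((singleFunctor C n).obj N) :=
  (h.shift (-n)).iso (shiftSingleIso N (-n) 0 n (by lia)).symm

lemma InEnvelope.stalk {W : ObjectProperty C}
    (hW : ∀ N, W N → InEnvelope M d ((singleFunctor C 0).obj N)) (hX : Stalk W X) :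
    InEnvelope M d X := by
  obtain ⟨N, n, hN, ⟨e⟩⟩ := hX
  exact ((hW N hN).single n).iso e

/-- At `k = n` both outer terms cost `1`, and joining them costs one more: `3`. Each descent in `k`
adds a single extension, its projective term costing `0`. -/
lemma IsSyzCone.inEnvelope [EnoughProjectives C] {n : ℕ} (k : ℕ) (hkn : k ≤ n)
    (hP : ∀ P : C, Projective P → InEnvelope M 0 ((singleFunctor C 0).obj P))
    (hW : ∀ N : C, IsSyz n N → InEnvelope M 1 ((singleFunctor C 0).obj N))
    (hX : IsSyzCone k X) : InEnvelope M (n - k + 3) X := by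
  induction hkn using Nat.decreasingInduction generalizing X with
  | self =>
    obtain ⟨Z, B, p, h, q, hT, hZ, hB⟩ := hX
    have hn : ∀ X, Stalk (IsSyz n) X → InEnvelope M 1 X := fun X => InEnvelope.stalk hW
    exact (InEnvelope.of_distTriang hT (.finiteSums hn hZ) (.finiteSums hn hB)).mono (by lia)
  | of_succ k hk ih =>
    obtain ⟨P, Y, s, t, r, hT, hP', hY⟩ := hX.exists_triangle
    exact (InEnvelope.of_distTriang hT (.finiteSums (fun X => InEnvelope.stalk hP) hP')
      (ih hY)).mono (by lia)

lemma triDim_bounded_le [EnoughProjectives C] (M : Bounded C) {n : ℕ} (hn : 1 ≤ n)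
    (hP : ∀ P : C, Projective P → InEnvelope M 0 ((singleFunctor C 0).obj P))
    (hW : ∀ N : C, IsSyz n N → InEnvelope M 1 ((singleFunctor C 0).obj N)) :
    triDim (Bounded C) ≤ (n : ℕ∞) + 2 := by
  refine iInf₂_le_of_le (n + 2) ⟨M, ?_⟩ (by simp)
  rw [eq_top_iff]
  rintro ⟨X, hX⟩ -
  obtain ⟨_, h⟩ := ((isSyzCone_one_of_bounded X hX).inEnvelope 1 hn hP hW).mono
    (show n - 1 + 3 ≤ n + 2 by lia)
  exact h

end BoundedEnvelope

/-! ### The closure `add V`. -/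

section AddClosure

attribute [local instance] Abelian.hasFiniteBiproducts

variable {C : Type u} [Category.{v} C] [Abelian C]

lemma MemAdd.retract {V X Y : C} (hY : MemAdd V Y) (r : Retract X Y) : MemAdd V X := by
  obtain ⟨m, ⟨s⟩⟩ := hY
  exact ⟨m, ⟨r.trans s⟩⟩

lemma memAdd_self (V : C) : MemAdd V V :=
  ⟨1, ⟨{ i := biproduct.lift fun _ => 𝟙 V, r := biproduct.π _ 0 }⟩⟩

lemma memAdd_zero (V : C) {X : C} (hX : IsZero X) : MemAdd V X :=
  ⟨0, ⟨{ i := 0, r := 0, retract := hX.eq_of_src _ _ }⟩⟩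

lemma MemAdd.biprod {V X Y : C} (hX : MemAdd V X) (hY : MemAdd V Y) : MemAdd V (X ⊞ Y) := by
  obtain ⟨m, ⟨r⟩⟩ := hX
  obtain ⟨n, ⟨s⟩⟩ := hY
  refine ⟨m + n, ⟨(retractBiprod r s).trans
    { i := biproduct.lift (Fin.addCases (fun j => biprod.fst ≫ biproduct.π _ j)
        (fun j => biprod.snd ≫ biproduct.π _ j))
      r := biprod.lift (biproduct.lift fun j => biproduct.π _ (Fin.castAdd n j))
        (biproduct.lift fun j => biproduct.π _ (Fin.natAdd m j))
      retract := ?_ }⟩⟩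
  apply biprod.hom_ext <;> apply biproduct.hom_ext <;> intro j <;> simp

/-- The biproduct of `m + 1` copies of `V` is a retract of the sum of `V` and `m` copies. -/
noncomputable def retractBiproductSucc (V : C) (m : ℕ) :
    Retract (⨁ fun _ : Fin (m + 1) => V) (V ⊞ ⨁ fun _ : Fin m => V) where
  i := biprod.lift (biproduct.π _ 0) (biproduct.lift fun j => biproduct.π _ j.succ)
  r := biproduct.lift (Fin.cases biprod.fst (fun j => biprod.snd ≫ biproduct.π _ j))
  retract := by
    apply biproduct.hom_ext
    intro j
    cases j using Fin.cases <;> simp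

lemma MemAdd.induction {V : C} (Q : ObjectProperty C) (hV : Q V)
    (hr : ∀ {X Y : C}, Retract X Y → Q Y → Q X) (hs : ∀ {X Y : C}, Q X → Q Y → Q (X ⊞ Y))
    {X : C} (hX : MemAdd V X) : Q X := by
  obtain ⟨m, ⟨r⟩⟩ := hX
  refine hr r ?_
  clear r
  induction m with
  | zero => exact hr { i := 0, r := 0, retract := by apply biproduct.hom_ext; simp } hV
  | succ m ih => exact hr (retractBiproductSucc V m) (hs hV ih)

lemma MemAdd.trans {U V X : C} (hV : MemAdd U V) (hX : MemAdd V X) : MemAdd U X :=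
  hX.induction (MemAdd U) hV (fun r h => h.retract r) MemAdd.biprod

lemma memAdd_biprod_left (U V : C) : MemAdd (U ⊞ V) U :=
  (memAdd_self _).retract { i := biprod.inl, r := biprod.fst }

lemma memAdd_biprod_right (U V : C) : MemAdd (U ⊞ V) V :=
  (memAdd_self _).retract { i := biprod.inr, r := biprod.snd }

end AddClosure

/-! ### Schanuel's lemma for retracts. -/

section StableSyzygies

open ZeroObject

variable {C : Type u} [Category.{v} C] [Abelian C]

/-- Syzygies of a stable retract are stable retracts. -/
lemma exists_retract_of_shortExact {S₁ S₂ : ShortComplex C} (h₁ : S₁.ShortExact)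
    (h₂ : S₂.ShortExact) [Projective S₁.X₂] [Projective S₂.X₂] {P : C} [Projective P]
    (r : Retract S₁.X₃ (S₂.X₃ ⊞ P)) : Nonempty (Retract S₁.X₁ (S₂.X₁ ⊞ S₁.X₂)) := by
  have := h₁.mono_f
  have := h₂.mono_f
  have := h₁.epi_g
  have := h₂.epi_g
  let s := Projective.factorThru (S₁.g ≫ r.i ≫ biprod.fst) S₂.g
  let t := Projective.factorThru (S₂.g ≫ biprod.inl ≫ r.r) S₁.g
  let t' := Projective.factorThru (biprod.inr ≫ r.r) S₁.g
  have hs : s ≫ S₂.g = S₁.g ≫ r.i ≫ biprod.fst := Projective.factorThru_comp _ _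
  have ht : t ≫ S₁.g = S₂.g ≫ biprod.inl ≫ r.r := Projective.factorThru_comp _ _
  have ht' : t' ≫ S₁.g = biprod.inr ≫ r.r := Projective.factorThru_comp _ _
  let a := h₂.exact.lift (S₁.f ≫ s) (by rw [Category.assoc, hs, S₁.zero_assoc, zero_comp])
  let b := h₁.exact.lift (S₂.f ≫ t) (by rw [Category.assoc, ht, S₂.zero_assoc, zero_comp])
  have ha : a ≫ S₂.f = S₁.f ≫ s := h₂.exact.lift_f _ _
  have hb : b ≫ S₁.f = S₂.f ≫ t := h₁.exact.lift_f _ _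
  have hr : r.i ≫ biprod.fst ≫ biprod.inl ≫ r.r + r.i ≫ biprod.snd ≫ biprod.inr ≫ r.r = 𝟙 _ := by
    rw [← r.retract, ← Preadditive.comp_add]
    congr 1
    rw [← Category.assoc, ← Category.assoc biprod.snd, ← Preadditive.add_comp, biprod.total,
      Category.id_comp]
  -- On `S₁.X₂` the lifts compose to the identity only up to a map killed by `S₁.g`; `c` is this
  -- defect, and `a ≫ b + S₁.f ≫ c = 𝟙`.
  let c := h₁.exact.lift (𝟙 _ - s ≫ t - S₁.g ≫ r.i ≫ biprod.snd ≫ t') (by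
    simp only [Preadditive.sub_comp, Category.assoc, ht, ht', Category.id_comp]
    rw [reassoc_of% hs, sub_sub, ← Preadditive.comp_add, hr, Category.comp_id, sub_self])
  have hc : c ≫ S₁.f = 𝟙 _ - s ≫ t - S₁.g ≫ r.i ≫ biprod.snd ≫ t' := h₁.exact.lift_f _ _
  refine ⟨{ i := biprod.lift a S₁.f, r := biprod.desc b c, retract := ?_ }⟩
  rw [biprod.lift_desc, ← cancel_mono S₁.f, Preadditive.add_comp, Category.assoc, Category.assoc,
    hb, hc, reassoc_of% ha]
  simp

/-- Induction with Schanuel's lemma. It transfers the Igusa–Todorov condition, which concerns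
minimal syzygies, to the arbitrary ones met above. -/
lemma exists_retract_of_isSyzygy {n : ℕ} {M W Y : C} (hW : Syz n M W) (hY : IsSyzygy n M Y) :
    ∃ P : C, Projective P ∧ Nonempty (Retract W (Y ⊞ P)) := by
  induction n generalizing W Y with
  | zero =>
    obtain ⟨e⟩ := hW
    obtain ⟨e'⟩ := hY
    exact ⟨0, inferInstance, ⟨(Retract.ofIso (e ≪≫ e'.symm)).trans
      { i := biprod.inl, r := biprod.fst }⟩⟩
  | succ n ih =>
    obtain ⟨P, W', i, p, h, hS, hP, hW'⟩ := hW
    obtain ⟨Z, Q, f, hZ, hf, ⟨e⟩⟩ := hY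
    obtain ⟨R, hR, ⟨r⟩⟩ := ih hW' hZ
    have := hf.epi
    have : Projective (ShortComplex.mk i p h).X₂ := hP
    have : Projective (ShortComplex.mk _ _ (kernel.condition f)).X₂ := hf.projective
    obtain ⟨s⟩ := exists_retract_of_shortExact hS (shortExact_kernel f) r
    exact ⟨P, hP, ⟨s.trans (retractBiprod (Retract.ofIso e.symm) (Retract.refl _))⟩⟩

end StableSyzygies

/-! ### The dimension bound for abelian categories. -/

section IgusaTodorov

open Pretriangulated DerivedCategory

variable {C : Type u} [Category.{v} C] [Abelian C] [HasDerivedCategory.{w} C]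
  {M : Bounded C}

lemma InEnvelope.single_retract {d : ℕ} {X Y : C}
    (hY : InEnvelope M d ((singleFunctor C 0).obj Y)) (r : Retract X Y) :
    InEnvelope M d ((singleFunctor C 0).obj X) :=
  hY.retract (r.map _)

lemma InEnvelope.single_biprod {d : ℕ} {X Y : C}
    (hX : InEnvelope M d ((singleFunctor C 0).obj X))
    (hY : InEnvelope M d ((singleFunctor C 0).obj Y)) :
    InEnvelope M d ((singleFunctor C 0).obj (X ⊞ Y)) := by
  have := preservesBinaryBiproducts_of_preservesBiproducts (singleFunctor C 0)
  exact (hX.biprod hY).iso ((singleFunctor C 0).mapBiprod X Y)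

lemma InEnvelope.memAdd {d : ℕ} {V X : C} (hV : InEnvelope M d ((singleFunctor C 0).obj V))
    (hX : MemAdd V X) : InEnvelope M d ((singleFunctor C 0).obj X) :=
  hX.induction (fun X => InEnvelope M d ((singleFunctor C 0).obj X)) hV
    (fun r h => h.single_retract r) InEnvelope.single_biprod

lemma InEnvelope.hasTwoTermAddResolution {V Y : C}
    (hV : InEnvelope M 0 ((singleFunctor C 0).obj V)) (hY : HasTwoTermAddResolution V Y) :
    InEnvelope M 1 ((singleFunctor C 0).obj Y) := by
  obtain ⟨V₁, V₀, i, q, h, hS, h₁, h₀⟩ := hY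
  obtain ⟨δ, hT⟩ := exists_single_distTriang hS 0
  exact .of_distTriang (mk_rot_distTriang hT) (hV.memAdd h₀) ((hV.memAdd h₁).shift 1)

/-- The dimension bound, for an abelian category whose projectives are the summands of finite
sums of a projective generator `G`. -/
lemma triDim_bounded_le_of_igusaTodorov [EnoughProjectives C] {G V : C}
    (hG : ∀ P : C, Projective P → MemAdd G P) {n : ℕ}
    (hV : ∀ X : C, ∃ Y : C, IsSyzygy n X Y ∧ HasTwoTermAddResolution V Y) :
    triDim (Bounded C) ≤ ((max 1 n : ℕ) : ℕ∞) + 2 := by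
  let M : Bounded C := ⟨(singleFunctor C 0).obj (G ⊞ V), ⟨0, inferInstance⟩, ⟨0, inferInstance⟩⟩
  have hM : InEnvelope M 0 ((singleFunctor C 0).obj (G ⊞ V)) := .self M
  have hM' : InEnvelope M 0 ((singleFunctor C 0).obj V) := hM.memAdd (memAdd_biprod_right _ _)
  have hP (P : C) (hP : Projective P) : InEnvelope M 0 ((singleFunctor C 0).obj P) :=
    hM.memAdd ((memAdd_biprod_left _ _).trans (hG P hP))
  refine triDim_bounded_le M (le_max_left _ _) hP fun N hN => ?_
  obtain ⟨X, hX⟩ : ∃ X, Syz n X N := by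
    -- For `n = 0` the object `N` is its own zeroth syzygy; that it is also a first syzygy plays no
    -- role.
    obtain rfl | hn := Nat.eq_zero_or_pos n
    · exact ⟨N, ⟨Iso.refl _⟩⟩
    · rwa [max_eq_right (Nat.succ_le_of_lt hn)] at hN
  obtain ⟨Y, hY, hY'⟩ := hV X
  obtain ⟨P, hP', ⟨r⟩⟩ := exists_retract_of_isSyzygy hX hY
  exact ((hM'.hasTwoTermAddResolution hY').single_biprod
    ((hP P hP').mono zero_le_one)).single_retract r

end IgusaTodorov

/-! ### Finitely generated modules. -/

section FGModules

attribute [local instance] Abelian.hasFiniteBiproducts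

variable {R : Type u} [Ring R]

lemma FGModuleCat.epi_of_surjective {M N : FGModuleCat.{u} R} (f : M ⟶ N)
    (hf : Function.Surjective f.hom.hom) : Epi f where
  left_cancellation g h hgh := by
    ext x
    obtain ⟨y, rfl⟩ := hf x
    exact congr($(hgh).hom.hom y)

lemma FGModuleCat.surjective_of_epi {M N : FGModuleCat.{u} R} (f : M ⟶ N) [Epi f] :
    Function.Surjective f.hom.hom := by
  let q : N ⟶ FGModuleCat.of R (N ⧸ LinearMap.range f.hom.hom) :=
    FGModuleCat.ofHom (Submodule.mkQ _)
  have hq : q = 0 := by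
    rw [← cancel_epi f, comp_zero]
    ext x
    exact (Submodule.Quotient.mk_eq_zero _).2 ⟨x, rfl⟩
  rw [← LinearMap.range_eq_top, eq_top_iff]
  rintro x -
  exact (Submodule.Quotient.mk_eq_zero _).1 congr($(hq).hom.hom x)

lemma FGModuleCat.mono_of_injective {M N : FGModuleCat.{u} R} (f : M ⟶ N)
    (hf : Function.Injective f.hom.hom) : Mono f where
  right_cancellation g h hgh := by
    ext x
    exact hf congr($(hgh).hom.hom x)

lemma FGModuleCat.projective_of_module_projective (P : FGModuleCat.{u} R)
    [Module.Projective R P] : Projective P where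
  factors f e _ := by
    obtain ⟨g, hg⟩ := Module.projective_lifting_property e.hom.hom f.hom.hom
      (FGModuleCat.surjective_of_epi e)
    exact ⟨FGModuleCat.ofHom g, by ext x; exact congr($hg x)⟩

lemma FGModuleCat.exists_epi_free (M : FGModuleCat.{u} R) :
    ∃ (n : ℕ) (f : FGModuleCat.of R (Fin n → R) ⟶ M), Epi f := by
  obtain ⟨n, f, hf⟩ := Module.Finite.exists_fin' R M
  exact ⟨n, FGModuleCat.ofHom f, FGModuleCat.epi_of_surjective _ hf⟩

variable [IsNoetherianRing R]

instance FGModuleCat.enoughProjectives : EnoughProjectives (FGModuleCat.{u} R) where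
  presentation M := by
    obtain ⟨n, f, hf⟩ := FGModuleCat.exists_epi_free M
    have : Projective (FGModuleCat.of R (Fin n → R)) :=
      FGModuleCat.projective_of_module_projective _
    exact ⟨⟨_, f⟩⟩

lemma FGModuleCat.injective_of_mono {M N : FGModuleCat.{u} R} (f : M ⟶ N) [Mono f] :
    Function.Injective f.hom.hom := by
  let i : FGModuleCat.of R (LinearMap.ker f.hom.hom) ⟶ M := FGModuleCat.ofHom (Submodule.subtype _)
  have hi : i = 0 := by
    rw [← cancel_mono f, zero_comp]
    ext x
    exact x.2
  rw [← LinearMap.ker_eq_bot, eq_bot_iff]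
  exact fun x hx => congr($(hi).hom.hom ⟨x, hx⟩)

lemma FGModuleCat.memAdd_free (n : ℕ) :
    MemAdd (FGModuleCat.of R R) (FGModuleCat.of R (Fin n → R)) := by
  refine ⟨n, ⟨{
    i := biproduct.lift fun i => FGModuleCat.ofHom (LinearMap.proj i)
    r := biproduct.desc fun i => FGModuleCat.ofHom (LinearMap.single R (fun _ => R) i)
    retract := ?_ }⟩⟩
  rw [biproduct.lift_desc]
  apply (ModuleCat.isFG R).ι.map_injective
  rw [Functor.map_sum]
  apply ModuleCat.hom_ext
  rw [ModuleCat.hom_sum]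
  refine LinearMap.ext fun x => ?_
  rw [LinearMap.sum_apply]
  exact Finset.univ_sum_single x

lemma FGModuleCat.memAdd_of_projective (P : FGModuleCat.{u} R) [Projective P] :
    MemAdd (FGModuleCat.of R R) P := by
  obtain ⟨n, f, hf⟩ := FGModuleCat.exists_epi_free P
  exact (FGModuleCat.memAdd_free n).retract
    { i := Projective.factorThru (𝟙 P) f, r := f, retract := Projective.factorThru_comp _ _ }

lemma derivedDim_le_of_isIgusaTodorov (Λ : Type u) [Ring Λ] [IsArtinAlgebra Λ]
    [HasDerivedCategory.{w} (RightMod Λ)] (n : ℕ) (h : IsIgusaTodorov n Λ) :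
    derivedDim Λ ≤ ((max 1 n : ℕ) : ℕ∞) + 2 := by
  obtain ⟨V, hV⟩ := h
  exact triDim_bounded_le_of_igusaTodorov
    (fun P _ => FGModuleCat.memAdd_of_projective P) hV

end FGModules

/-! ### Projective covers and the radical. -/

section ProjectiveCovers

variable {R : Type u} [Ring R]

/-- Embed `P` as a summand of `Rⁿ`: the coordinates of `x` lie in `rad R`, and projecting back
writes `x` as a combination with these coefficients. -/
lemma FGModuleCat.jacobson_smul_of_projective (P : FGModuleCat.{u} R) [Projective P]
    {x : P} (hx : x ∈ Module.jacobson R P) :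
    x ∈ Ring.jacobson R • (⊤ : Submodule R P) := by
  obtain ⟨n, f, hf⟩ := FGModuleCat.exists_epi_free P
  let s : P ⟶ FGModuleCat.of R (Fin n → R) := Projective.factorThru (𝟙 P) f
  have hs : s ≫ f = 𝟙 P := Projective.factorThru_comp _ _
  let g : P →ₗ[R] (Fin n → R) := s.hom.hom
  let h : (Fin n → R) →ₗ[R] P := f.hom.hom
  have hgh : h (g x) = x := congr($(hs).hom.hom x)
  have hc (i : Fin n) : g x i ∈ Ring.jacobson R :=
    Module.map_jacobson_le (LinearMap.proj i ∘ₗ g) ⟨x, hx, rfl⟩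
  rw [← hgh, ← Finset.univ_sum_single (g x), map_sum]
  refine Submodule.sum_mem _ fun i _ => ?_
  have : Pi.single i (g x i) = g x i • (Pi.single i 1 : Fin n → R) := by
    rw [← Pi.single_smul, smul_eq_mul, mul_one]
  rw [this, map_smul]
  exact Submodule.smul_mem_smul (hc i) trivial

/-- The kernel of a projective cover lies in the radical. -/
lemma IsProjectiveCover.ker_le_jacobson {P M : FGModuleCat.{u} R} [IsNoetherianRing R] {f : P ⟶ M}
    (hf : IsProjectiveCover f) : LinearMap.ker f.hom.hom ≤ Module.jacobson R P := by
  refine le_sInf fun m hm => ?_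
  by_contra hle
  have htop : m ⊔ LinearMap.ker f.hom.hom = ⊤ := hm.2 _ (left_lt_sup.2 hle)
  let g : FGModuleCat.of R m ⟶ P := FGModuleCat.ofHom m.subtype
  have := hf.epi
  have hg : Epi (g ≫ f) := by
    refine FGModuleCat.epi_of_surjective _ fun y => ?_
    obtain ⟨x, rfl⟩ := FGModuleCat.surjective_of_epi f y
    obtain ⟨a, ha, b, hb, rfl⟩ := Submodule.mem_sup.1 (htop.ge (Submodule.mem_top (x := x)))
    refine ⟨⟨a, ha⟩, ?_⟩
    rw [map_add, LinearMap.mem_ker.1 hb, add_zero]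
    rfl
  have := hf.essential g hg
  refine hm.1 (eq_top_iff.2 fun x _ => ?_)
  obtain ⟨y, rfl⟩ := FGModuleCat.surjective_of_epi g x
  exact y.2

/-- A projective of minimal length mapping onto `M` works. By Fitting's lemma, the range of a high
power of an endomorphism over `M` is a summand still mapping onto `M`, hence everything. -/
lemma FGModuleCat.exists_isProjectiveCover [IsArtinianRing R] (M : FGModuleCat.{u} R) :
    ∃ (P : FGModuleCat.{u} R) (f : P ⟶ M), IsProjectiveCover f := by
  let T := { x : Σ P : FGModuleCat.{u} R, P ⟶ M // Projective x.1 ∧ Epi x.2 }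
  obtain ⟨⟨⟨P, f⟩, hP, hf⟩, -, hmin⟩ :=
    (InvImage.wf (fun x : T => Module.length R x.1.1) wellFounded_lt).has_min Set.univ
      ⟨⟨⟨_, Projective.π M⟩, inferInstance, inferInstance⟩, trivial⟩
  refine ⟨P, f, hP, hf, fun {Y} g hg => ?_⟩
  let e : P →ₗ[R] P := (Projective.factorThru f (g ≫ f) ≫ g).hom.hom
  have he (x : P) : f.hom.hom (e x) = f.hom.hom x := by
    have := Projective.factorThru_comp f (g ≫ f)
    rw [← Category.assoc] at this
    exact congr($(this).hom.hom x)
  have hepow (n : ℕ) (x : P) : f.hom.hom ((e ^ n) x) = f.hom.hom x := by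
    induction n with
    | zero => rfl
    | succ n ih => rw [pow_succ', Module.End.mul_apply, he, ih]
  -- The exponent must be positive, so that surjectivity of `e ^ n` passes to `e` and then to `g`.
  obtain ⟨n, hn, hn'⟩ := ((LinearMap.eventually_isCompl_ker_pow_range_pow e).and
    (Filter.eventually_ge_atTop 1)).exists
  let Q : FGModuleCat.{u} R := FGModuleCat.of R (LinearMap.range (e ^ n))
  let i : Q ⟶ P := FGModuleCat.ofHom (Submodule.subtype _)
  let r : P ⟶ Q := FGModuleCat.ofHom (Submodule.projectionOnto _ _ hn.symm)
  have hQ : Projective Q := Retract.projective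
    { i := i, r := r, retract := by
        ext x
        exact congr(($(Submodule.projectionOnto_apply_left hn.symm x) : P)) }
  have hi : Epi (i ≫ f) := by
    refine FGModuleCat.epi_of_surjective _ fun y => ?_
    obtain ⟨x, rfl⟩ := FGModuleCat.surjective_of_epi f y
    exact ⟨⟨(e ^ n) x, x, rfl⟩, hepow n x⟩
  have htop : LinearMap.range (e ^ n) = ⊤ := by
    by_contra h
    exact hmin ⟨⟨Q, i ≫ f⟩, hQ, hi⟩ trivial (Submodule.length_lt h)
  refine FGModuleCat.epi_of_surjective _ fun x => ?_
  obtain ⟨y, rfl⟩ := htop.ge (Submodule.mem_top (x := x))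
  obtain ⟨n, rfl⟩ := Nat.exists_eq_add_of_le' hn'
  rw [pow_succ', Module.End.mul_apply]
  exact ⟨_, rfl⟩

/-- Nilpotence of the radical is insensitive to sides: `y * c.unop` is nilpotent, so `1 + y *
c.unop` is invertible. -/
lemma unop_mem_jacobson {Λ : Type u} [Ring Λ] [IsArtinianRing Λᵐᵒᵖ] {c : Λᵐᵒᵖ}
    (hc : c ∈ Ring.jacobson Λᵐᵒᵖ) : c.unop ∈ Ring.jacobson Λ := by
  rw [← Ideal.jacobson_bot, Ideal.mem_jacobson_iff]
  intro y
  obtain ⟨n, hn⟩ := IsSemiprimaryRing.isNilpotent (R := Λᵐᵒᵖ)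
  have hy : IsNilpotent (y * c.unop) := by
    refine ⟨n, MulOpposite.op_injective ?_⟩
    have := Ideal.pow_mem_pow (Ideal.mul_mem_right (MulOpposite.op y) _ hc) n
    rw [hn] at this
    simpa using this
  obtain ⟨z, hz⟩ := hy.isUnit_one_add.exists_left_inv
  refine ⟨z, ?_⟩
  rw [mul_add, mul_one] at hz
  rw [Ideal.mem_bot, mul_assoc, add_comm, hz, sub_self]

end ProjectiveCovers

/-! ### Syzygies and extensions inside `add`. -/

section AddClosureOfSyzygies

variable {C : Type u} [Category.{v} C] [Abelian C]

attribute [local instance] Abelian.hasFiniteBiproducts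

lemma memAdd_biproduct {m : ℕ} (X : Fin m → C) (i : Fin m) : MemAdd (⨁ X) (X i) :=
  (memAdd_self _).retract { i := biproduct.ι X i, r := biproduct.π X i }

lemma MemAdd.map {D : Type*} [Category D] [Abelian D] (F : C ⥤ D) [F.Additive] {V X : C}
    (hX : MemAdd V X) : MemAdd (F.obj V) (F.obj X) := by
  have := preservesBinaryBiproducts_of_preservesBiproducts F
  exact hX.induction (fun X => MemAdd (F.obj V) (F.obj X)) (memAdd_self _)
    (fun r h => h.retract (r.map F))
    (fun {X Y} hX hY => (hX.biprod hY).retract (Retract.ofIso (F.mapBiprod X Y)))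

/-- The kernel of a direct sum of morphisms is a retract of the sum of the kernels. -/
noncomputable def retractKernelBiprodMap {X₁ X₂ Y₁ Y₂ : C} (f : X₁ ⟶ Y₁) (g : X₂ ⟶ Y₂) :
    Retract (kernel (biprod.map f g)) (kernel f ⊞ kernel g) where
  i := biprod.lift
    (kernel.lift f (kernel.ι _ ≫ biprod.fst) (by
      rw [Category.assoc, ← biprod.map_fst f g, kernel.condition_assoc, zero_comp]))
    (kernel.lift g (kernel.ι _ ≫ biprod.snd) (by
      rw [Category.assoc, ← biprod.map_snd f g, kernel.condition_assoc, zero_comp]))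
  r := kernel.lift _ (biprod.map (kernel.ι f) (kernel.ι g)) (by
    apply biprod.hom_ext <;> simp)
  retract := by
    rw [← cancel_mono (kernel.ι _)]
    apply biprod.hom_ext <;> simp

/-- The first syzygies of the objects of `add U` lie in `add U'` for a single `U'`. -/
lemma exists_memAdd_kernel [EnoughProjectives C] {G : C}
    (hG : ∀ P : C, Projective P → MemAdd G P) (U : C) :
    ∃ U' : C, ∀ {X P : C} (f : P ⟶ X), Projective P → Epi f → MemAdd U X →
      MemAdd U' (kernel f) := by
  refine ⟨kernel (Projective.π U) ⊞ G, fun {X P} f _ _ hX => ?_⟩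
  -- Schanuel's lemma makes the choice of presentation irrelevant; the summand `G` absorbs the extra
  -- projective.
  have key {X Y P Q : C} (f : P ⟶ X) (g : Q ⟶ Y) (hP : Projective P) (hQ : Projective Q)
      (hf : Epi f) (hg : Epi g) (r : Retract X Y)
      (h : MemAdd (kernel (Projective.π U) ⊞ G) (kernel g)) :
      MemAdd (kernel (Projective.π U) ⊞ G) (kernel f) := by
    have : Projective (ShortComplex.mk _ _ (kernel.condition f)).X₂ := hP
    have : Projective (ShortComplex.mk _ _ (kernel.condition g)).X₂ := hQ
    obtain ⟨s⟩ := exists_retract_of_shortExact (shortExact_kernel f) (shortExact_kernel g)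
      (P := Q) (r.trans { i := biprod.inl, r := biprod.fst })
    exact (h.biprod ((memAdd_biprod_right _ _).trans (hG P hP))).retract s
  refine hX.induction (fun X => ∀ {P : C} (f : P ⟶ X), Projective P → Epi f →
    MemAdd (kernel (Projective.π U) ⊞ G) (kernel f)) ?_ ?_ ?_ f ‹_› ‹_›
  · intro P f hP hf
    exact key f (Projective.π U) hP inferInstance hf inferInstance (Retract.refl _)
      (memAdd_biprod_left _ _)
  · intro X Y r hY P f hP hf
    exact key f (Projective.π Y) hP inferInstance hf inferInstance r
      (hY _ inferInstance inferInstance)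
  · intro X Y hX hY P f hP hf
    exact key f (biprod.map (Projective.π X) (Projective.π Y)) hP inferInstance hf inferInstance
      (Retract.refl _)
      (((hX _ inferInstance inferInstance).biprod (hY _ inferInstance inferInstance)).retract
        (retractKernelBiprodMap _ _))

/-- An extension of `X₃` by `X₁` is a quotient of the sum of `X₁` and a projective cover of `X₃`,
the kernel being the syzygy of `X₃`. -/
lemma exists_retract_kernel_desc {S : ShortComplex C} (hS : S.ShortExact) {P : C} [Projective P]
    (e : P ⟶ S.X₃) [Epi e] :
    ∃ q : S.X₁ ⊞ P ⟶ S.X₂, Epi q ∧ Nonempty (Retract (kernel q) (kernel e)) := by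
  have := hS.mono_f
  have := hS.epi_g
  let s := Projective.factorThru e S.g
  have hs : s ≫ S.g = e := Projective.factorThru_comp _ _
  let t := hS.exact.lift (kernel.ι e ≫ s) (by rw [Category.assoc, hs, kernel.condition])
  have ht : t ≫ S.f = kernel.ι e ≫ s := hS.exact.lift_f _ _
  let q : S.X₁ ⊞ P ⟶ S.X₂ := biprod.desc S.f s
  have hq : kernel.ι q ≫ biprod.fst ≫ S.f + kernel.ι q ≫ biprod.snd ≫ s = 0 := by
    rw [← Preadditive.comp_add, ← biprod.desc_eq, kernel.condition]
  refine ⟨q, ?_, ⟨?_⟩⟩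
  · refine Preadditive.epi_of_cancel_zero _ fun {Z} g hg => ?_
    have h₁ : S.f ≫ g = 0 := by simpa [q] using biprod.inl ≫= hg
    have h₂ : s ≫ g = 0 := by simpa [q] using biprod.inr ≫= hg
    have h₃ : e ≫ hS.exact.desc g h₁ = 0 := by
      rw [← hs, Category.assoc, hS.exact.g_desc, h₂]
    rw [← hS.exact.g_desc g h₁, (cancel_epi e).1 (h₃.trans comp_zero.symm), comp_zero]
  · refine
      -- The kernel of `q` consists of the pairs `(-t z, z)` with `z` in the kernel of `e`.
      { i := kernel.lift e (kernel.ι q ≫ biprod.snd) ?_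
        r := kernel.lift q (biprod.lift (-t) (kernel.ι e)) ?_
        retract := ?_ }
    · have := hq =≫ S.g
      simpa [hs] using this
    · simp [q, ht]
    · rw [← cancel_mono (kernel.ι q)]
      apply biprod.hom_ext
      · rw [← cancel_mono S.f]
        simp only [Category.assoc, kernel.lift_ι, biprod.lift_fst, Category.id_comp,
          Preadditive.neg_comp, Preadditive.comp_neg, ht, kernel.lift_ι_assoc]
        exact (eq_neg_of_add_eq_zero_left hq).symm
      · simp

end AddClosureOfSyzygies

/-! ### Representation-finite rings and restriction to quotients. -/

section RepresentationFinite

attribute [local instance] Abelian.hasFiniteBiproducts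

lemma FGModuleCat.isZero_iff_subsingleton {R : Type u} [Ring R] (M : FGModuleCat.{u} R) :
    IsZero M ↔ Subsingleton M := by
  refine ⟨fun h => ⟨fun x y => ?_⟩,
    fun h => ⟨fun X => ⟨⟨⟨0⟩, fun f => ?_⟩⟩, fun X => ⟨⟨⟨0⟩, fun f => ?_⟩⟩⟩⟩
  · have (z : M) : z = 0 := congr($(h.eq_of_src (𝟙 M) 0).hom.hom z)
    rw [this x, this y]
  · ext x
    rw [Subsingleton.elim x 0, map_zero, map_zero]
  · ext x
    exact Subsingleton.elim _ _

lemma FGModuleCat.length_biprod {S : Type u} [Ring S] [IsNoetherianRing S]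
    {M X Y : FGModuleCat.{u} S}
    (e : M ≅ X ⊞ Y) : Module.length S M = Module.length S X + Module.length S Y := by
  let i : X ⟶ M := biprod.inl ≫ e.inv
  let p : M ⟶ X := e.hom ≫ biprod.fst
  let j : Y ⟶ M := biprod.inr ≫ e.inv
  let q : M ⟶ Y := e.hom ≫ biprod.snd
  have hip : i ≫ p = 𝟙 _ := by simp [i, p]
  have hjq : j ≫ q = 𝟙 _ := by simp [j, q]
  have hiq : i ≫ q = 0 := by simp [i, q]
  have htot : p ≫ i + q ≫ j = 𝟙 _ := by
    simp only [p, i, q, j, Category.assoc, ← Preadditive.comp_add]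
    rw [← Category.assoc biprod.fst, ← Category.assoc biprod.snd, ← Preadditive.add_comp,
      biprod.total, Category.id_comp, Iso.hom_inv_id]
  refine Module.length_eq_add_of_exact i.hom.hom q.hom.hom
    (Function.LeftInverse.injective (g := p.hom.hom) fun x => congr($(hip).hom.hom x))
    (Function.RightInverse.surjective (g := j.hom.hom) fun x => congr($(hjq).hom.hom x))
    fun x => ⟨fun hx => ⟨p.hom.hom x, ?_⟩, ?_⟩
  · have : i.hom.hom (p.hom.hom x) + j.hom.hom (q.hom.hom x) = x := congr($(htot).hom.hom x)
    rwa [hx, map_zero, add_zero] at this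
  · rintro ⟨y, rfl⟩
    exact congr($(hiq).hom.hom y)

/-- Over an artinian ring with finitely many indecomposable modules, all finitely generated modules
are summands of sums of copies of a single one. -/
lemma FGModuleCat.memAdd_of_indecomposables {S : Type u} [Ring S] [IsArtinianRing S] {m : ℕ}
    (X : Fin m → FGModuleCat.{u} S)
    (hX : ∀ M : FGModuleCat.{u} S, Indecomposable M → ∃ i, Nonempty (M ≅ X i))
    (M : FGModuleCat.{u} S) : MemAdd (⨁ X) M := by
  induction hl : Module.length S M using WellFoundedLT.induction generalizing M with
  | ind l ih =>
    by_cases h0 : IsZero M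
    · exact memAdd_zero _ h0
    by_cases hM : Indecomposable M
    · obtain ⟨i, ⟨e⟩⟩ := hX M hM
      exact (memAdd_biproduct X i).retract (Retract.ofIso e)
    · obtain ⟨Y, Z, e, hY, hZ⟩ : ∃ (Y Z : FGModuleCat.{u} S) (_ : M ≅ Y ⊞ Z),
          ¬ IsZero Y ∧ ¬ IsZero Z := by
        simpa [Indecomposable, h0] using hM
      have hlen := FGModuleCat.length_biprod e
      have pos {N : FGModuleCat.{u} S} (hN : ¬ IsZero N) : Module.length S N ≠ 0 := by
        rwa [Ne, Module.length_eq_zero_iff, ← FGModuleCat.isZero_iff_subsingleton]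
      refine ((ih _ ?_ Y rfl).biprod (ih _ ?_ Z rfl)).retract (Retract.ofIso e)
      · rw [← hl, hlen, add_comm]
        exact ENat.lt_add_left Module.length_ne_top (pos hZ).bot_lt
      · rw [← hl, hlen]
        exact ENat.lt_add_left Module.length_ne_top (pos hY).bot_lt

/-- Restriction of scalars along a surjective ring homomorphism. -/
noncomputable def FGModuleCat.restrict {R S : Type u} [Ring R] [Ring S] (π : R →+* S)
    (hπ : Function.Surjective π) : FGModuleCat.{u} S ⥤ FGModuleCat.{u} R :=
  (ModuleCat.isFG R).lift ((ModuleCat.isFG S).ι ⋙ ModuleCat.restrictScalars π) fun M => by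
    obtain ⟨s, hs⟩ := Module.Finite.fg_top (R := S) (M := M)
    refine (ModuleCat.isFG_iff _).2 ⟨s, eq_top_iff.2 fun (x : M) _ => ?_⟩
    have hx : x ∈ Submodule.span S (s : Set M) := hs.ge trivial
    induction hx using Submodule.span_induction with
    | mem x hx => exact Submodule.subset_span hx
    | zero => exact Submodule.zero_mem _
    | add x y _ _ hx hy => exact Submodule.add_mem _ (hx trivial) (hy trivial)
    | smul a x _ hx =>
      obtain ⟨r, rfl⟩ := hπ a
      exact Submodule.smul_mem _ r (hx trivial)

instance {R S : Type u} [Ring R] [Ring S] (π : R →+* S) (hπ : Function.Surjective π) :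
    (FGModuleCat.restrict π hπ).Additive where
  map_add := rfl

lemma FGModuleCat.exists_restrict_iso {R S : Type u} [Ring R] [Ring S] (π : R →+* S)
    (hπ : Function.Surjective π) (N : FGModuleCat.{u} R)
    (hN : ∀ r : R, π r = 0 → ∀ x : N, r • x = 0) :
    ∃ M : FGModuleCat.{u} S, Nonempty (N ≅ (FGModuleCat.restrict π hπ).obj M) := by
  let φ : S →+* AddMonoid.End N := RingHom.liftOfSurjective π hπ
    ⟨Module.toAddMonoidEnd R N, fun r hr => by
      ext x
      exact hN r hr x⟩
  have hφ (r : R) : φ (π r) = Module.toAddMonoidEnd R N r :=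
    RingHom.liftOfRightInverse_comp_apply _ _ _ _ _
  let _ : Module S N := Module.compHom N φ
  have hsmul (r : R) (x : N) : π r • x = r • x := congr($(hφ r) x)
  have : Module.Finite S N := by
    obtain ⟨s, hs⟩ := Module.Finite.fg_top (R := R) (M := N)
    refine ⟨s, eq_top_iff.2 fun x _ => ?_⟩
    have hx : x ∈ Submodule.span R (s : Set N) := hs.ge trivial
    induction hx using Submodule.span_induction with
    | mem x hx => exact Submodule.subset_span hx
    | zero => exact Submodule.zero_mem _
    | add x y _ _ hx hy => exact Submodule.add_mem _ (hx trivial) (hy trivial)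
    | smul a x _ hx =>
      rw [← hsmul]
      exact Submodule.smul_mem _ _ (hx trivial)
  let e : N ≃ₗ[R] (FGModuleCat.restrict π hπ).obj (FGModuleCat.of S N) :=
    { AddEquiv.refl N with map_smul' := fun r x => (hsmul r x).symm }
  exact ⟨FGModuleCat.of S N, ⟨e.toFGModuleCatIso⟩⟩

lemma FGModuleCat.exists_memAdd_of_indecomposables {R S : Type u} [Ring R] [Ring S]
    [IsNoetherianRing R] [IsArtinianRing S] (π : R →+* S) (hπ : Function.Surjective π) {m : ℕ}
    (X : Fin m → FGModuleCat.{u} S)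
    (hX : ∀ M : FGModuleCat.{u} S, Indecomposable M → ∃ i, Nonempty (M ≅ X i)) :
    ∃ U : FGModuleCat.{u} R, ∀ N : FGModuleCat.{u} R,
      (∀ r : R, π r = 0 → ∀ x : N, r • x = 0) → MemAdd U N := by
  refine ⟨(FGModuleCat.restrict π hπ).obj (⨁ X), fun N hN => ?_⟩
  obtain ⟨M, ⟨e⟩⟩ := FGModuleCat.exists_restrict_iso π hπ N hN
  exact ((FGModuleCat.memAdd_of_indecomposables X hX M).map (FGModuleCat.restrict π hπ)).retract
    (Retract.ofIso e)

end RepresentationFinite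

/-! ### Radical powers and the final theorem. -/

section RadicalPowers

lemma IsArtinAlgebra.isArtinianRing_mulOpposite (Λ : Type u) [Ring Λ] [IsArtinAlgebra Λ] :
    IsArtinianRing Λᵐᵒᵖ := by
  obtain ⟨k, _, _, _, _⟩ := IsArtinAlgebra.exists_base (Λ := Λ)
  have : Module.Finite k Λᵐᵒᵖ := Module.Finite.equiv (MulOpposite.opLinearEquiv k)
  exact IsArtinianRing.of_finite k Λᵐᵒᵖ

variable {Λ : Type u} [Ring Λ] [IsArtinAlgebra Λ]

/-- A syzygy taken in a projective cover is annihilated by `radᵐ Λ` when `radᵐ⁺¹ Λ = 0`. -/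
lemma IsProjectiveCover.smul_eq_zero_of_mem_ker {P M : RightMod Λ} {f : P ⟶ M}
    (hf : IsProjectiveCover f) {m : ℕ} (hm : Ring.jacobson Λ ^ (m + 1) = ⊥) {c : Λ}
    (hc : c ∈ Ring.jacobson Λ ^ m) {x : P} (hx : f.hom.hom x = 0) : MulOpposite.op c • x = 0 := by
  have := IsArtinAlgebra.isArtinianRing_mulOpposite Λ
  have := hf.projective
  have hx' := FGModuleCat.jacobson_smul_of_projective P (hf.ker_le_jacobson hx)
  clear hx
  induction hx' using Submodule.smul_induction_on' with
  | smul r hr y _ =>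
    have : r.unop * c ∈ Ring.jacobson Λ ^ (m + 1) := by
      rw [Ideal.IsTwoSided.pow_succ]
      exact Ideal.mul_mem_mul (unop_mem_jacobson hr) hc
    rw [hm, Ideal.mem_bot] at this
    rw [smul_smul, show MulOpposite.op c * r = MulOpposite.op (r.unop * c) from rfl, this,
      MulOpposite.op_zero, zero_smul]
  | add y _ z _ hy hz => rw [smul_add, hy, hz, add_zero]

/-- A module annihilated by the square of an ideal `I` is an extension of two modules annihilated
by `I`. -/
lemma exists_shortExact_of_smul_eq_zero (I : Ideal Λ) [I.IsTwoSided] (Y : RightMod Λ)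
    (hY : ∀ c ∈ I, ∀ d ∈ I, ∀ y : Y, MulOpposite.op (c * d) • y = 0) :
    ∃ (S : ShortComplex (RightMod Λ)) (_ : S.ShortExact), S.X₂ = Y ∧
      (∀ c ∈ I, ∀ y : S.X₁, MulOpposite.op c • y = 0) ∧
      (∀ c ∈ I, ∀ y : S.X₃, MulOpposite.op c • y = 0) := by
  let A : Submodule Λᵐᵒᵖ Y :=
    { carrier := {y | ∀ c ∈ I, MulOpposite.op c • y = 0}
      add_mem' := fun ha hb c hc => by rw [smul_add, ha c hc, hb c hc, add_zero]
      zero_mem' := fun c _ => smul_zero _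
      smul_mem' := fun r y hy c hc => by
        rw [smul_smul]
        exact hy _ (I.mul_mem_left r.unop hc) }
  let i : FGModuleCat.of Λᵐᵒᵖ A ⟶ Y := FGModuleCat.ofHom A.subtype
  have : Mono i := FGModuleCat.mono_of_injective _ Subtype.val_injective
  refine ⟨ShortComplex.mk i (cokernel.π i) (cokernel.condition i), shortExact_cokernel i, rfl,
    fun c hc y => Subtype.ext (y.2 c hc), fun c hc y => ?_⟩
  obtain ⟨y, rfl⟩ := FGModuleCat.surjective_of_epi (cokernel.π i) y
  rw [← map_smul]
  -- `A` is the part killed by `I`; as `I²` kills `Y`, multiplication by `I` lands in `A`.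
  have hc : MulOpposite.op c • y ∈ A := fun d hd => by
    rw [smul_smul]
    exact hY c hc d hd y
  exact congr($(cokernel.condition i).hom.hom ⟨_, hc⟩)

/-- In `V = (U ⊞ G) ⊞ U'`, `U` carries the modules over `Λ/rad^p`, `G` the projectives, and `U'` the
syzygies of objects of `add U`. -/
lemma isIgusaTodorov_one_of_isRepresentationFinite (p : ℕ)
    (hp : Ring.jacobson Λ ^ (2 * p + 1) = ⊥)
    (h : IsRepresentationFinite (Λ ⧸ Ring.jacobson Λ ^ p)) : IsIgusaTodorov 1 Λ := by
  have := IsArtinAlgebra.isArtinianRing_mulOpposite Λ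
  have := IsArtinAlgebra.isArtinianRing_mulOpposite (Λ ⧸ Ring.jacobson Λ ^ p)
  obtain ⟨m, X, hX⟩ := h
  let π : Λᵐᵒᵖ →+* (Λ ⧸ Ring.jacobson Λ ^ p)ᵐᵒᵖ := (Ideal.Quotient.mk _).op
  have hπ : Function.Surjective π := fun y => by
    obtain ⟨x, hx⟩ := Ideal.Quotient.mk_surjective y.unop
    exact ⟨MulOpposite.op x, MulOpposite.unop_injective hx⟩
  obtain ⟨U, hU⟩ := FGModuleCat.exists_memAdd_of_indecomposables π hπ X hX
  have hU' (N : RightMod Λ)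
      (hN : ∀ c ∈ Ring.jacobson Λ ^ p, ∀ x : N, MulOpposite.op c • x = 0) : MemAdd U N :=
    hU N fun r hr => hN r.unop (Ideal.Quotient.eq_zero_iff_mem.1 (MulOpposite.op_injective hr))
  have hG (P : RightMod Λ) (_ : Projective P) := FGModuleCat.memAdd_of_projective P
  obtain ⟨U', hU''⟩ := exists_memAdd_kernel hG U
  let G : RightMod Λ := FGModuleCat.of Λᵐᵒᵖ Λᵐᵒᵖ
  refine ⟨(U ⊞ G) ⊞ U', fun M => ?_⟩
  obtain ⟨P, f, hf⟩ := FGModuleCat.exists_isProjectiveCover M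
  refine ⟨kernel f, ⟨M, P, f, ⟨Iso.refl _⟩, hf, ⟨Iso.refl _⟩⟩, ?_⟩
  obtain ⟨S, hS, hS₂, h₁, h₃⟩ := exists_shortExact_of_smul_eq_zero (Ring.jacobson Λ ^ p) (kernel f)
    (by
      intro c hc d hd y
      have hcd : c * d ∈ Ring.jacobson Λ ^ (2 * p) := by
        rw [two_mul, Ideal.IsTwoSided.pow_add]
        exact Ideal.mul_mem_mul hc hd
      apply FGModuleCat.injective_of_mono (kernel.ι f)
      rw [map_smul, map_zero]
      exact hf.smul_eq_zero_of_mem_ker hp hcd congr($(kernel.condition f).hom.hom y))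
  obtain ⟨q, _, ⟨r⟩⟩ := exists_retract_kernel_desc hS (Projective.π S.X₃)
  rw [← hS₂]
  refine ⟨kernel q, _, kernel.ι q, q, kernel.condition q, shortExact_kernel q, ?_, ?_⟩
  · exact (memAdd_biprod_right _ _).trans
      ((hU'' _ inferInstance inferInstance (hU' _ h₃)).retract r)
  · exact (memAdd_biprod_left _ _).trans
      (((memAdd_biprod_left _ _).trans (hU' _ h₁)).biprod
        ((memAdd_biprod_right _ _).trans (hG _ inferInstance)))

end RadicalPowers

theorem mainTheorem6 (Λ : Type u) [Ring Λ] [IsArtinAlgebra Λ]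
    [HasDerivedCategory.{w} (RightMod Λ)] :
    (∀ n : ℕ, 1 ≤ n → IsIgusaTodorov n Λ → derivedDim Λ ≤ (n : ℕ∞) + 2) ∧
    (IsIgusaTodorov 0 Λ → derivedDim Λ ≤ 3) ∧
    (IsIgusaTodorov 1 Λ → derivedDim Λ ≤ 3) ∧
    (∀ p : ℕ, Ring.jacobson Λ ^ (2 * p + 1) = ⊥ →
      IsRepresentationFinite (Λ ⧸ Ring.jacobson Λ ^ p) →
        IsIgusaTodorov 1 Λ ∧ derivedDim Λ ≤ 3) := by
  have h₃ (n : ℕ) (hn : n ≤ 1) (h : IsIgusaTodorov n Λ) : derivedDim Λ ≤ 3 := by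
    have := derivedDim_le_of_isIgusaTodorov Λ n h
    rwa [max_eq_left hn] at this
  refine ⟨fun n hn h => ?_, h₃ 0 zero_le_one, h₃ 1 le_rfl, fun p hp h => ?_⟩
  · have := derivedDim_le_of_isIgusaTodorov Λ n h
    rwa [max_eq_right hn] at this
  · have := isIgusaTodorov_one_of_isRepresentationFinite p hp h
    exact ⟨this, h₃ 1 le_rfl this⟩
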